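/- Fix $K\ge 0$ and consider terminals $T_0$ (source), $T_1,\dots,T_K$ (relays) and $T_{K+1}$ (destination), finite alphabets $\mathcal S_0,\dots,\mathcal S_{K+1}$, $\mathcal X_0,\dots,\mathcal X_K$, $\mathcal Y_1,\dots,\mathcal Y_{K+1}$, a joint probability mass function $p(s_0,\dots,s_{K+1})$ and a channel $p(y_1,\dots,y_{K+1}\mid x_0,\dots,x_K)$. The vectors $(S_{0,l},\dots,S_{K+1,l})$, $l\ge 1$, are i.i.d. with law $p(s_0,\dots,s_{K+1})$; terminal $T_i$ observes $S_i^m$, and the channel is memoryless. An $(m,n)$ code consists of a source encoder $X_0^n=f_0(S_0^m)$, relay encoders $X_{i,t}=f_{i,t}(Y_{i,1},\dots,Y_{i,t-1},S_i^m)$ for $1\le i\le K$, $1\le t\le n$, and a decoder $\hat S_0^m=g(Y_{K+1}^n,S_{K+1}^m)\in\mathcal S_0^m$. Its error probability is $P_e^{(m,n)}=\Pr\{\hat S_0^m\ne S_0^m\}$. A rate $r\ge 0$ (source samples per channel use) is achievable if there is a sequence of $(m,n)$ codes with $m/n\ge r$, $m,n\to\infty$ and $P_e^{(m,n)}\to 0$.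 **Theorem.** Let $r\ge 0$. Suppose that there are an integer $1\le N\le K+1$, an injection $\pi:\{0,\dots,N\}\to\{0,\dots,K+1\}$ with $\pi(0)=0$ and $\pi(N)=K+1$, and an input distribution $p(x_0,\dots,x_K)$ under which the inputs $(X_{\pi(0)},\dots,X_{\pi(N-1)})$ of the cooperating terminals are independent of the inputs of the relays outside the image of $\pi$ (no restriction if there are no such relays), such that $$ r<\frac{I\bigl(X_{\pi(0)},\dots,X_{\pi(i-1)};\,Y_{\pi(i)}\,\big|\,X_{\pi(i)},\dots,X_{\pi(N-1)}\bigr)}{H(S_0\mid S_{\pi(i)})}\qquad\text{for all } i=1,\dots,N, $$ where the mutual information is computed under $p(x_0,\dots,x_K)\,p(y_1,\dots,y_{K+1}\mid x_0,\dots,x_K)$ and a quotient with denominator $0$ is read as $+\infty$. Then the source-channel code rate $r$ is achievable. -/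

import Mathlib

/-!
Conventions.  The terminals are indexed by `Fin (K + 2)`: `0` is the source, `1, …, K` are the
relays, `K + 1 = Fin.last (K + 1)` is the destination.

* `S i`, for `i : Fin (K + 2)`, is the alphabet of the signal observed by terminal `i`;
* `X j`, for `j : Fin (K + 1)`, is the input alphabet of terminal `j.castSucc` (that is, `j`);
* `Y v`, for `v : Fin (K + 1)`, is the output alphabet of terminal `v.succ` (that is, `v + 1`).

Probability mass functions on a finite set are the elements of `stdSimplex ℝ _`.
Entropies are in nats; only their quotients matter.
-/

namespace RelayNetwork

section Information

variable {Ω α β γ : Type*}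

open Classical in
/-- The probability `P(f = a)` when the outcome has probability mass function `p`. -/
noncomputable def law [Fintype Ω] (p : Ω → ℝ) (f : Ω → α) (a : α) : ℝ :=
  ∑ ω, if f ω = a then p ω else 0

/-- Conditional entropy `H(f | g) = ∑ p(a, b) log (p(b) / p(a, b))`, with `0 log _ = 0`. -/
noncomputable def condEntropy [Fintype Ω] [Fintype α] [Fintype β]
    (p : Ω → ℝ) (f : Ω → α) (g : Ω → β) : ℝ :=
  ∑ a, ∑ b, law p (fun ω => (f ω, g ω)) (a, b) *
    Real.log (law p g b / law p (fun ω => (f ω, g ω)) (a, b))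

/-- Conditional mutual information
`I(f ; g | h) = ∑ p(a, b, c) log (p(a, b, c) p(c) / (p(a, c) p(b, c)))`, with `0 log _ = 0`. -/
noncomputable def condMutualInfo [Fintype Ω] [Fintype α] [Fintype β] [Fintype γ]
    (p : Ω → ℝ) (f : Ω → α) (g : Ω → β) (h : Ω → γ) : ℝ :=
  ∑ a, ∑ b, ∑ c, law p (fun ω => (f ω, g ω, h ω)) (a, b, c) *
    Real.log (law p (fun ω => (f ω, g ω, h ω)) (a, b, c) * law p h c /
      (law p (fun ω => (f ω, h ω)) (a, c) * law p (fun ω => (g ω, h ω)) (b, c)))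

end Information

section Network

variable {K : ℕ}

/-- The subtuple `x_A` of a tuple `x` of channel inputs. -/
def sub {X : Fin (K + 1) → Type*} (A : Finset (Fin (K + 1))) (x : ∀ j, X j) :
    ∀ j : {j // j ∈ A}, X j.1 :=
  fun j => x j.1

/-- An `(m, n)` joint source-channel code.  The relay indexed by `k : Fin K` is terminal `k + 1`.
At time `t` (counted from `0`) it has seen the `t` previous channel outputs. -/
structure Code (S : Fin (K + 2) → Type*) (X Y : Fin (K + 1) → Type*) (m n : ℕ) where
  /-- the encoder of the source terminal -/
  enc : (Fin m → S 0) → Fin n → X 0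
  /-- the causal encoders of the relays -/
  relay : ∀ (k : Fin K) (t : Fin n), (Fin t.1 → Y k.castSucc) →
    (Fin m → S k.succ.castSucc) → X k.succ
  /-- the decoder of the destination -/
  dec : (Fin n → Y (Fin.last K)) → (Fin m → S (Fin.last (K + 1))) → Fin m → S 0

variable {S : Fin (K + 2) → Type*} {X Y : Fin (K + 1) → Type*} {m n : ℕ}

/-- The channel inputs at time `t`, when `s` is the block of source and side information symbols
and `y` is the block of channel outputs (of which only those before time `t` are used). -/
def Code.input (c : Code S X Y m n) (s : Fin m → ∀ i, S i) (y : Fin n → ∀ v, Y v) (t : Fin n) :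
    ∀ j, X j :=
  Fin.cases (c.enc (fun l => s l 0) t)
    (fun k => c.relay k t (fun u => y (Fin.castLE t.2.le u) k.castSucc)
      (fun l => s l k.succ.castSucc))

/-- The joint probability of the block `s` of i.i.d. source and side information symbols and the
block `y` of outputs of the memoryless channel `W`, when the code `c` is used. -/
def Code.prob (c : Code S X Y m n) (pS : (∀ i, S i) → ℝ) (W : (∀ j, X j) → (∀ v, Y v) → ℝ)
    (s : Fin m → ∀ i, S i) (y : Fin n → ∀ v, Y v) : ℝ :=
  (∏ l, pS (s l)) * ∏ t, W (c.input s y t) (y t)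

open Classical in
/-- The probability that the destination's estimate differs from the source block. -/
noncomputable def Code.errorProb [∀ i, Fintype (S i)] [∀ v, Fintype (Y v)]
    (c : Code S X Y m n) (pS : (∀ i, S i) → ℝ) (W : (∀ j, X j) → (∀ v, Y v) → ℝ) : ℝ :=
  ∑ s : Fin m → ∀ i, S i, ∑ y : Fin n → ∀ v, Y v,
    if c.dec (fun t => y t (Fin.last K)) (fun l => s l (Fin.last (K + 1))) ≠ (fun l => s l 0)
    then c.prob pS W s y else 0

/-- The source-channel code rate `r` (source samples per channel use) is achievable: there is a
sequence of `(m, n)` codes with `m / n ≥ r`, `m, n → ∞`, and vanishing error probability. -/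
def Achievable [∀ i, Fintype (S i)] [∀ v, Fintype (Y v)]
    (pS : (∀ i, S i) → ℝ) (W : (∀ j, X j) → (∀ v, Y v) → ℝ) (r : ℝ) : Prop :=
  ∃ (m n : ℕ → ℕ) (c : ∀ q, Code S X Y (m q) (n q)),
    (∀ q, 0 < n q ∧ r ≤ (m q : ℝ) / (n q : ℝ)) ∧
    Filter.Tendsto m Filter.atTop Filter.atTop ∧
    Filter.Tendsto n Filter.atTop Filter.atTop ∧
    Filter.Tendsto (fun q => (c q).errorProb pS W) Filter.atTop (nhds 0)

/-- The joint probability mass function of channel inputs and outputs. -/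
def jointLaw (pX : (∀ j, X j) → ℝ) (W : (∀ j, X j) → (∀ v, Y v) → ℝ) :
    (∀ j, X j) × (∀ v, Y v) → ℝ :=
  fun xy => pX xy.1 * W xy.1 xy.2

variable {N : ℕ}

/-- The transmitters `π(0), …, π(i - 1)`. -/
def before (π : Fin (N + 1) → Fin (K + 2)) (i : Fin (N + 1)) : Finset (Fin (K + 1)) :=
  {j | ∃ l, l < i ∧ π l = j.castSucc}

/-- The transmitters `π(i), …, π(N - 1)` (if `π(N)` is the destination, it is no transmitter). -/
def after (π : Fin (N + 1) → Fin (K + 2)) (i : Fin (N + 1)) : Finset (Fin (K + 1)) :=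
  {j | ∃ l, i ≤ l ∧ π l = j.castSucc}

/-- All cooperating transmitters `π(0), …, π(N - 1)`. -/
def cooperating (π : Fin (N + 1) → Fin (K + 2)) : Finset (Fin (K + 1)) :=
  {j | ∃ l, π l = j.castSucc}

/-- The inputs of the transmitters in `A` are independent of the other inputs. -/
def IndepOfRest [∀ j, Fintype (X j)] (pX : (∀ j, X j) → ℝ) (A : Finset (Fin (K + 1))) : Prop :=
  ∀ x, pX x = law pX (sub A) (sub A x) * law pX (sub Aᶜ) (sub Aᶜ x)

/-- The conditional entropy `H(S_0 | S_i)`. -/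
noncomputable def sourceEntropy [∀ i, Fintype (S i)] (pS : (∀ i, S i) → ℝ) (i : Fin (K + 2)) : ℝ :=
  condEntropy pS (fun s => s 0) (fun s => s i)

/-- `I(X_{π(0:i-1)} ; Y | X_{π(i:N-1)})`, where `Y` is the channel output indexed by `v`. -/
noncomputable def rateInfo [∀ j, Fintype (X j)] [∀ v, Fintype (Y v)]
    (pX : (∀ j, X j) → ℝ) (W : (∀ j, X j) → (∀ v, Y v) → ℝ)
    (π : Fin (N + 1) → Fin (K + 2)) (i : Fin (N + 1)) (v : Fin (K + 1)) : ℝ :=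
  condMutualInfo (jointLaw pX W) (fun xy => sub (before π i) xy.1) (fun xy => xy.2 v)
    (fun xy => sub (after π i) xy.1)

end Network

end RelayNetwork

/-!
Decode-and-forward with superposition block Markov coding.  The levels are the positions of `π`.
Source block `b` is carried by level `k < N` in the channel block `b + k`, and the terminal of level
`i` decodes it at the end of the channel block `b + i - 1`, so that it can then take part in sending
it.  It accepts the candidates whose score exceeds a threshold; the score is the posterior
probability given the side information, times a density ratio of the channel outputs for each of the
levels `0, …, i - 1`.  With random codebooks the mean scores of the wrong candidates sum to at most
one, while the logarithm of the score of the true candidate has drift `-r H + I > 0` per channel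
use, so a negative moment of it decays exponentially.  Over many source blocks the `N` extra channel
blocks cost no rate.

The cooperating inputs are dependent, but the codewords of the levels should not be.  So a letter is
a map which sends the inputs chosen by the higher levels to an input tuple with the right
conditional law.  The remaining relays send what the top letter alone determines, which has the
right joint law with the cooperating inputs by the independence hypothesis.
-/

namespace RelayNetwork

section ProductLaws

theorem sum_prod_eq_one {I : Type*} {V : I → Type*} [Fintype I] [DecidableEq I]
    [∀ i, Fintype (V i)] {q : ∀ i, V i → ℝ} (hq : ∀ i, ∑ v, q i v = 1) :
    ∑ C : ∀ i, V i, ∏ i, q i (C i) = 1 := by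
  rw [← Fintype.prod_sum]
  simp only [hq, Finset.prod_const_one]

variable {I V : Type*} [Fintype I] [DecidableEq I] [Fintype V] {q : I → V → ℝ}

theorem sum_prod_mul_restrict (hq : ∀ i, ∑ v, q i v = 1) (P : I → Prop) [DecidablePred P]
    (F : ({i // P i} → V) → ℝ) :
    ∑ C : I → V, (∏ i, q i (C i)) * F (fun i => C i) =
      ∑ v : {i // P i} → V, (∏ i, q i.1 (v i)) * F v := by
  rw [← (Equiv.piEquivPiSubtypeProd P fun _ => V).symm.sum_comp, Fintype.sum_prod_type]
  refine Finset.sum_congr rfl fun v _ => ?_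
  have hsplit (v' : {i // ¬ P i} → V) :
      (∏ i, q i ((Equiv.piEquivPiSubtypeProd P fun _ => V).symm (v, v') i)) =
        (∏ i, q i.1 (v i)) * ∏ i, q i.1 (v' i) := by
    rw [← Fintype.prod_subtype_mul_prod_subtype P]
    congr 1 <;> refine Finset.prod_congr rfl fun i _ => ?_
    · simp [i.2]
    · simp [i.2]
  have hrest : ∑ v' : {i // ¬ P i} → V, ∏ i, q i.1 (v' i) = 1 := sum_prod_eq_one fun i => hq i
  have hF (v' : {i // ¬ P i} → V) :
      (fun i : {i // P i} => (Equiv.piEquivPiSubtypeProd P fun _ => V).symm (v, v') i) = v := by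
    funext i
    simp [i.2]
  simp only [hsplit, hF, mul_right_comm _ _ (F v), ← Finset.mul_sum, hrest, mul_one]

theorem sum_prod_mul_comp {J : Type*} [Fintype J] [DecidableEq J] (hq : ∀ i, ∑ v, q i v = 1)
    {e : J → I} (he : Function.Injective e) (F : (J → V) → ℝ) :
    ∑ C : I → V, (∏ i, q i (C i)) * F (C ∘ e) = ∑ v : J → V, (∏ j, q (e j) (v j)) * F v := by
  classical
  let E : J ≃ {i // ∃ j, e j = i} := Equiv.ofInjective e he
  refine (sum_prod_mul_restrict hq (fun i => ∃ j, e j = i) fun v => F (v ∘ E)).trans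
    (Fintype.sum_equiv (E.symm.arrowCongr (Equiv.refl V)) _ _ fun v => ?_)
  rw [← E.prod_comp]
  rfl

theorem sum_prod_mul_prod_comp {J : Type*} [Fintype J] (hq : ∀ i, ∑ v, q i v = 1)
    {e : J → I} (he : Function.Injective e) (g : J → V → ℝ) :
    ∑ C : I → V, (∏ i, q i (C i)) * ∏ j, g j (C (e j)) = ∏ j, ∑ v, q (e j) v * g j v := by
  classical
  refine (sum_prod_mul_comp hq he fun v => ∏ j, g j (v j)).trans ?_
  simp only [Fintype.prod_sum, Finset.prod_mul_distrib]

/-- `k t y z` is the probability of the symbol `z` at time `t` after the past of `y`. -/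
theorem sum_prod_causal {Z : Type*} [Fintype Z] [Nonempty Z] {n : ℕ}
    (k : Fin n → (Fin n → Z) → Z → ℝ) (hk : ∀ t y, ∑ z, k t y z = 1)
    (hc : ∀ t y y', (∀ u < t, y u = y' u) → k t y = k t y') :
    ∑ y : Fin n → Z, ∏ t, k t y (y t) = 1 := by
  induction n with
  | zero => simp
  | succ n ih =>
    obtain ⟨z₀⟩ := ‹Nonempty Z›
    have hfirst (y : Fin (n + 1) → Z) : k 0 y = k 0 fun _ => z₀ :=
      hc 0 _ _ fun u hu => absurd hu u.not_lt_zero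
    have hrest (z : Z) :
        ∑ y : Fin n → Z, ∏ t : Fin n, k t.succ (Fin.cons (α := fun _ => Z) z y) (y t) = 1 := by
      refine ih (fun t y => k t.succ (Fin.cons (α := fun _ => Z) z y)) (fun t y => hk _ _)
        fun t y y' h => hc _ _ _ fun u hu => ?_
      cases u using Fin.cases with
      | zero => simp
      | succ u => simpa using h u (Fin.succ_lt_succ_iff.1 hu)
    rw [← (Fin.consEquiv fun _ => Z).sum_comp, Fintype.sum_prod_type]
    simp only [Fin.consEquiv, Equiv.coe_fn_mk, Fin.prod_univ_succ, Fin.cons_zero, Fin.cons_succ,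
      hfirst, ← Finset.mul_sum, hrest, mul_one]
    exact hk 0 _

end ProductLaws

section Averages

variable {Ω : Type*} [Fintype Ω] {p : Ω → ℝ}

theorem exists_pos_of_mem_stdSimplex (hp : p ∈ stdSimplex ℝ Ω) : ∃ ω, 0 < p ω := by
  by_contra! h
  linarith [Finset.sum_nonpos fun ω (_ : ω ∈ Finset.univ) => h ω, hp.2]

theorem exists_le_of_sum_mul_le (hp : p ∈ stdSimplex ℝ Ω) {f : Ω → ℝ} {ε : ℝ}
    (h : ∑ ω, p ω * f ω ≤ ε) : ∃ ω, f ω ≤ ε := by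
  by_contra! hlt
  obtain ⟨ω₀, hω₀⟩ := exists_pos_of_mem_stdSimplex hp
  have : ∑ ω, p ω * ε < ∑ ω, p ω * f ω :=
    Finset.sum_lt_sum (fun ω _ => mul_le_mul_of_nonneg_left (hlt ω).le (hp.1 ω))
      ⟨ω₀, Finset.mem_univ _, mul_lt_mul_of_pos_left (hlt ω₀) hω₀⟩
  rw [← Finset.sum_mul, hp.2, one_mul] at this
  linarith

open scoped Classical in
theorem sum_not_eq_of_agree {p p' : Ω → ℝ} (hp : ∑ ω, p ω = ∑ ω, p' ω) {G : Ω → Prop}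
    (h : ∀ ω, G ω → p ω = p' ω) :
    (∑ ω, if ¬ G ω then p ω else 0) = ∑ ω, if ¬ G ω then p' ω else 0 := by
  have hsplit (q : Ω → ℝ) : (∑ ω, if ¬ G ω then q ω else 0) =
      ∑ ω, q ω - ∑ ω, if G ω then q ω else 0 := by
    rw [← Finset.sum_sub_distrib]
    exact Finset.sum_congr rfl fun ω _ => by split_ifs <;> simp
  rw [hsplit, hsplit, hp]
  congr 1
  exact Finset.sum_congr rfl fun ω _ => by split_ifs with hω <;> simp [h ω, hω]

/-- The moment `E[f ^ (-s)]`, which controls the probability that `f` is small. -/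
noncomputable def negMoment (p f : Ω → ℝ) (s : ℝ) : ℝ := ∑ ω, p ω * f ω ^ (-s)

theorem negMoment_zero (p f : Ω → ℝ) : negMoment p f 0 = ∑ ω, p ω := by
  simp [negMoment]

theorem negMoment_pos (hp : p ∈ stdSimplex ℝ Ω) {f : Ω → ℝ} (hf : ∀ ω, 0 < p ω → 0 < f ω)
    (s : ℝ) : 0 < negMoment p f s := by
  obtain ⟨ω₀, hω₀⟩ := exists_pos_of_mem_stdSimplex hp
  refine Finset.sum_pos' (fun ω _ => ?_)
    ⟨ω₀, Finset.mem_univ _, mul_pos hω₀ (Real.rpow_pos_of_pos (hf _ hω₀) _)⟩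
  rcases (hp.1 ω).eq_or_lt with h | h
  · simp [← h]
  · exact mul_nonneg h.le (Real.rpow_nonneg (hf ω h).le _)

theorem hasDerivAt_negMoment_zero (hp : ∀ ω, 0 ≤ p ω) {f : Ω → ℝ}
    (hf : ∀ ω, 0 < p ω → 0 < f ω) :
    HasDerivAt (negMoment p f) (-∑ ω, p ω * Real.log (f ω)) 0 := by
  rw [← Finset.sum_neg_distrib]
  refine HasDerivAt.fun_sum fun ω _ => ?_
  rcases (hp ω).eq_or_lt with h | h
  · simpa [← h] using hasDerivAt_const (0 : ℝ) (0 : ℝ)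
  · simpa using ((hasDerivAt_neg (0 : ℝ)).const_rpow (hf ω h)).const_mul (p ω)

theorem hasDerivAt_log_negMoment_zero (hp : p ∈ stdSimplex ℝ Ω) {f : Ω → ℝ}
    (hf : ∀ ω, 0 < p ω → 0 < f ω) :
    HasDerivAt (fun s => Real.log (negMoment p f s)) (-∑ ω, p ω * Real.log (f ω)) 0 := by
  simpa [negMoment_zero, hp.2] using
    (hasDerivAt_negMoment_zero hp.1 hf).log (negMoment_pos hp hf 0).ne'

end Averages

open Filter Topology in
theorem eventually_lt_of_hasDerivAt_neg {g : ℝ → ℝ} {g' a : ℝ} (h : HasDerivAt g g' a)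
    (hg : g' < 0) : ∀ᶠ s in 𝓝[>] a, g s < g a := by
  have hslope := (hasDerivAt_iff_tendsto_slope.1 h).mono_left
    (nhdsWithin_mono a fun s (hs : a < s) => hs.ne')
  filter_upwards [hslope.eventually (gt_mem_nhds hg), self_mem_nhdsWithin] with s hs has
  rw [slope_def_field, div_lt_iff₀ (sub_pos.2 has), zero_mul] at hs
  linarith

section Law

variable {Ω α β γ : Type*} [Fintype Ω] {p : Ω → ℝ}

theorem law_nonneg (hp : ∀ ω, 0 ≤ p ω) (f : Ω → α) (a : α) : 0 ≤ law p f a :=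
  Finset.sum_nonneg fun ω _ => by split_ifs <;> simp [hp ω]

theorem le_law (hp : ∀ ω, 0 ≤ p ω) (f : Ω → α) (ω : Ω) : p ω ≤ law p f (f ω) := by
  classical
  refine le_of_eq_of_le ?_ (Finset.single_le_sum (f := fun ω' => if f ω' = f ω then p ω' else 0)
    (fun ω' _ => ?_) (Finset.mem_univ ω))
  · simp
  · split_ifs <;> simp [hp ω']

theorem law_pos (hp : ∀ ω, 0 ≤ p ω) (f : Ω → α) {ω : Ω} (hω : 0 < p ω) : 0 < law p f (f ω) :=
  hω.trans_le (le_law hp f ω)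

theorem law_le_law_comp (hp : ∀ ω, 0 ≤ p ω) (f : Ω → α) (φ : α → β) (a : α) :
    law p f a ≤ law p (fun ω => φ (f ω)) (φ a) :=
  Finset.sum_le_sum fun ω _ => by
    split_ifs with h h'
    · rfl
    · exact absurd (congrArg φ h) h'
    · exact hp ω
    · rfl

theorem law_congr (p : Ω → ℝ) {f : Ω → α} {g : Ω → β} {a : α} {b : β}
    (h : ∀ ω, f ω = a ↔ g ω = b) : law p f a = law p g b :=
  Finset.sum_congr rfl fun ω _ => by classical exact if_congr (h ω) rfl rfl

theorem sum_law_mul [Fintype α] (p : Ω → ℝ) (f : Ω → α) (Φ : α → ℝ) :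
    ∑ a, law p f a * Φ a = ∑ ω, p ω * Φ (f ω) := by
  classical
  simp only [law, Finset.sum_mul]
  rw [Finset.sum_comm]
  simp [ite_mul]

theorem sum_law_pair [Fintype α] (p : Ω → ℝ) (f : Ω → α) (g : Ω → β) (b : β) :
    ∑ a, law p (fun ω => (f ω, g ω)) (a, b) = law p g b := by
  classical
  simp only [law, Prod.mk.injEq, ite_and]
  rw [Finset.sum_comm]
  simp

end Law

section Information

variable {Ω α β γ : Type*} [Fintype Ω] {p : Ω → ℝ}

/-- The conditional probability `P(f = a | g = b)`, equal to `0` if `P(g = b) = 0`. -/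
noncomputable def condProb (p : Ω → ℝ) (f : Ω → α) (g : Ω → β) (a : α) (b : β) : ℝ :=
  law p (fun ω => (f ω, g ω)) (a, b) / law p g b

theorem condProb_nonneg (hp : ∀ ω, 0 ≤ p ω) (f : Ω → α) (g : Ω → β) (a : α) (b : β) :
    0 ≤ condProb p f g a b :=
  div_nonneg (law_nonneg hp _ _) (law_nonneg hp _ _)

theorem condProb_pos (hp : ∀ ω, 0 ≤ p ω) (f : Ω → α) (g : Ω → β) {ω : Ω} (hω : 0 < p ω) :
    0 < condProb p f g (f ω) (g ω) :=
  div_pos (law_pos hp (fun ω => (f ω, g ω)) hω) (law_pos hp g hω)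

theorem condProb_le_one (hp : ∀ ω, 0 ≤ p ω) (f : Ω → α) (g : Ω → β) (a : α) (b : β) :
    condProb p f g a b ≤ 1 :=
  div_le_one_of_le₀ (law_le_law_comp hp (fun ω => (f ω, g ω)) Prod.snd (a, b)) (law_nonneg hp g b)

theorem sum_condProb_le_one [Fintype α] (p : Ω → ℝ) (f : Ω → α) (g : Ω → β) (b : β) :
    ∑ a, condProb p f g a b ≤ 1 := by
  simp only [condProb, ← Finset.sum_div, sum_law_pair]
  exact div_self_le_one _

theorem condEntropy_eq_neg_sum [Fintype α] [Fintype β] (p : Ω → ℝ) (f : Ω → α) (g : Ω → β) :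
    condEntropy p f g = -∑ ω, p ω * Real.log (condProb p f g (f ω) (g ω)) := by
  have hinv (a : α) (b : β) : Real.log (law p g b / law p (fun ω => (f ω, g ω)) (a, b)) =
      -Real.log (condProb p f g a b) := by
    rw [condProb, ← Real.log_inv, inv_div]
  simp only [condEntropy, hinv]
  rw [← Fintype.sum_prod_type' fun a b => law p (fun ω => (f ω, g ω)) (a, b) *
      -Real.log (condProb p f g a b),
    sum_law_mul p (fun ω => (f ω, g ω)) fun ab => -Real.log (condProb p f g ab.1 ab.2)]
  simp only [mul_neg, Finset.sum_neg_distrib]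

theorem mul_log_condProb_nonpos (hp : ∀ ω, 0 ≤ p ω) (f : Ω → α) (g : Ω → β) (ω : Ω) :
    p ω * Real.log (condProb p f g (f ω) (g ω)) ≤ 0 :=
  mul_nonpos_of_nonneg_of_nonpos (hp ω)
    (Real.log_nonpos (condProb_nonneg hp f g _ _) (condProb_le_one hp f g _ _))

theorem condEntropy_nonneg [Fintype α] [Fintype β] (hp : ∀ ω, 0 ≤ p ω) (f : Ω → α) (g : Ω → β) :
    0 ≤ condEntropy p f g := by
  rw [condEntropy_eq_neg_sum, neg_nonneg]
  exact Finset.sum_nonpos fun ω _ => mul_log_condProb_nonpos hp f g ω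

theorem condProb_eq_one_of_condEntropy_eq_zero [Fintype α] [Fintype β] (hp : ∀ ω, 0 ≤ p ω)
    {f : Ω → α} {g : Ω → β} (h : condEntropy p f g = 0) {ω : Ω} (hω : 0 < p ω) :
    condProb p f g (f ω) (g ω) = 1 := by
  rw [condEntropy_eq_neg_sum, neg_eq_zero, Finset.sum_eq_zero_iff_of_nonpos
    fun ω _ => mul_log_condProb_nonpos hp f g ω] at h
  have hlog := (mul_eq_zero.1 (h ω (Finset.mem_univ ω))).resolve_left hω.ne'
  exact Real.eq_one_of_pos_of_log_eq_zero (condProb_pos hp f g hω) hlog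

theorem condProb_eq_zero_of_condEntropy_eq_zero [Fintype α] [Fintype β] (hp : ∀ ω, 0 ≤ p ω)
    {f : Ω → α} {g : Ω → β} (h : condEntropy p f g = 0) {ω : Ω} (hω : 0 < p ω) {a : α}
    (ha : a ≠ f ω) : condProb p f g a (g ω) = 0 := by
  classical
  have hsum := sum_condProb_le_one p f g (g ω)
  have hpair := Finset.add_le_sum (fun a _ => condProb_nonneg hp f g a (g ω))
    (Finset.mem_univ a) (Finset.mem_univ (f ω)) ha
  linarith [condProb_nonneg hp f g a (g ω), condProb_eq_one_of_condEntropy_eq_zero hp h hω]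

theorem condMutualInfo_eq_sum [Fintype α] [Fintype β] [Fintype γ] (p : Ω → ℝ) (f : Ω → α)
    (g : Ω → β) (h : Ω → γ) :
    condMutualInfo p f g h = ∑ ω, p ω * Real.log
      (law p (fun ω => (f ω, g ω, h ω)) (f ω, g ω, h ω) * law p h (h ω) /
        (law p (fun ω => (f ω, h ω)) (f ω, h ω) * law p (fun ω => (g ω, h ω)) (g ω, h ω))) := by
  rw [← sum_law_mul p (fun ω => (f ω, g ω, h ω)) fun x => Real.log
    (law p (fun ω => (f ω, g ω, h ω)) x * law p h x.2.2 /
      (law p (fun ω => (f ω, h ω)) (x.1, x.2.2) * law p (fun ω => (g ω, h ω)) x.2))]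
  simp only [condMutualInfo, Fintype.sum_prod_type]

end Information

section Conditioning

variable {Ω α β : Type*} [Fintype Ω] {p : Ω → ℝ}

/-- The conditional mean of `h` given `f`, as a function of the outcome.  It is `0` at the outcomes
whose value of `f` has probability `0`. -/
noncomputable def condMean (p h : Ω → ℝ) (f : Ω → α) (ω : Ω) : ℝ :=
  law (fun ω => p ω * h ω) f (f ω) / law p f (f ω)

theorem condMean_nonneg (hp : ∀ ω, 0 ≤ p ω) {h : Ω → ℝ} (hh : ∀ ω, 0 ≤ h ω) (f : Ω → α) (ω : Ω) :
    0 ≤ condMean p h f ω :=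
  div_nonneg (law_nonneg (fun ω => mul_nonneg (hp ω) (hh ω)) _ _) (law_nonneg hp _ _)

theorem condMean_pos (hp : ∀ ω, 0 ≤ p ω) {h : Ω → ℝ} (hh : ∀ ω, 0 ≤ h ω) (f : Ω → α) {ω : Ω}
    (hω : 0 < p ω) (hhω : 0 < h ω) : 0 < condMean p h f ω :=
  div_pos (law_pos (p := fun ω => p ω * h ω) (fun ω => mul_nonneg (hp ω) (hh ω)) f
    (mul_pos hω hhω)) (law_pos hp f hω)

theorem condMean_congr (p h : Ω → ℝ) {f : Ω → α} {ω ω' : Ω} (hω : f ω = f ω') :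
    condMean p h f ω = condMean p h f ω' := by
  rw [condMean, condMean, hω]

open scoped Classical in
/-- The conditional law of an outcome `ω'` given that `f` takes the value `f ω`.  If that value has
probability `0`, the outcome is kept: then `f ω' = f ω` holds in every case. -/
noncomputable def condLaw (p : Ω → ℝ) (f : Ω → α) (ω ω' : Ω) : ℝ :=
  if law p f (f ω) = 0 then if ω' = ω then 1 else 0
  else if f ω' = f ω then p ω' / law p f (f ω) else 0

theorem condLaw_nonneg (hp : ∀ ω, 0 ≤ p ω) (f : Ω → α) (ω ω' : Ω) : 0 ≤ condLaw p f ω ω' := by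
  unfold condLaw
  split_ifs <;> simp [div_nonneg (hp ω') (law_nonneg hp f (f ω))]

theorem eq_of_condLaw_ne_zero {f : Ω → α} {ω ω' : Ω} (h : condLaw p f ω ω' ≠ 0) : f ω' = f ω := by
  unfold condLaw at h
  split_ifs at h <;> simp_all

theorem sum_condLaw_mul {f : Ω → α} {ω : Ω} (hω : law p f (f ω) ≠ 0) (Φ : Ω → ℝ) :
    ∑ ω', condLaw p f ω ω' * Φ ω' = law (fun ω' => p ω' * Φ ω') f (f ω) / law p f (f ω) := by
  simp only [condLaw, if_neg hω]
  refine (Finset.sum_congr rfl fun ω' _ => ?_).trans (Finset.sum_div ..).symm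
  split_ifs <;> ring

theorem sum_condLaw (p : Ω → ℝ) (f : Ω → α) (ω : Ω) : ∑ ω', condLaw p f ω ω' = 1 := by
  by_cases hω : law p f (f ω) = 0
  · classical simp [condLaw, hω]
  · simpa [div_self hω] using sum_condLaw_mul hω 1

theorem condLaw_of_subsingleton [Subsingleton α] (hp : ∑ ω, p ω = 1) (f : Ω → α) (ω : Ω) :
    condLaw p f ω = p := by
  have hlaw : law p f (f ω) = 1 := by simpa [law, Subsingleton.elim _ (f ω)] using hp
  funext ω'
  simp [condLaw, hlaw, Subsingleton.elim (f ω') (f ω)]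

theorem sum_mul_condLaw_mul (hp : ∀ ω, 0 ≤ p ω) (f : Ω → α) (Φ : Ω → ℝ) :
    ∑ ω, p ω * ∑ ω', condLaw p f ω ω' * Φ ω' = ∑ ω, p ω * Φ ω := by
  classical
  have hzero (ω : Ω) (hω : law p f (f ω) = 0) : p ω = 0 :=
    le_antisymm (hω ▸ le_law hp f ω) (hp ω)
  have hswap (ω ω' : Ω) : p ω * (condLaw p f ω ω' * Φ ω') =
      (if f ω = f ω' then p ω else 0) * (p ω' * Φ ω' / law p f (f ω')) := by
    by_cases hω : law p f (f ω) = 0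
    · simp [hzero ω hω]
    · simp only [condLaw, if_neg hω, eq_comm (a := f ω')]
      split_ifs with h
      · rw [h]; ring
      · simp
  simp only [Finset.mul_sum, hswap]
  rw [Finset.sum_comm]
  refine Finset.sum_congr rfl fun ω' _ => ?_
  rw [← Finset.sum_mul]
  exact mul_div_cancel_of_imp' fun h => by rw [hzero ω' h, zero_mul]

theorem sum_mul_condMean_mul (hp : ∀ ω, 0 ≤ p ω) (h : Ω → ℝ) (g : Ω → β) (Φ : β → ℝ) :
    ∑ ω, p ω * (condMean p h g ω * Φ (g ω)) = ∑ ω, p ω * h ω * Φ (g ω) := by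
  simp only [mul_assoc (p _)]
  rw [← sum_mul_condLaw_mul hp g fun ω => h ω * Φ (g ω)]
  refine Finset.sum_congr rfl fun ω _ => ?_
  by_cases hω : law p g (g ω) = 0
  · rw [le_antisymm (hω ▸ le_law hp g ω) (hp ω), zero_mul, zero_mul]
  · simp only [sum_condLaw_mul hω, condMean, div_mul_eq_mul_div, law, Finset.sum_mul]
    refine congrArg (fun x => p ω * (x / _)) (Finset.sum_congr rfl fun ω' _ => ?_)
    split_ifs with h'
    · rw [h', mul_assoc]
    · exact zero_mul _

theorem sum_condLaw_mul_condMean (hp : ∀ ω, 0 ≤ p ω) (h : Ω → ℝ) (g : Ω → β) (φ : β → α)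
    {ω : Ω} (hω : law p (fun ω => φ (g ω)) (φ (g ω)) ≠ 0) :
    ∑ ω', condLaw p (fun ω => φ (g ω)) ω ω' * condMean p h g ω' =
      condMean p h (fun ω => φ (g ω)) ω := by
  classical
  rw [sum_condLaw_mul hω, condMean]
  congr 1
  simpa [law, mul_ite] using
    sum_mul_condMean_mul hp h g fun b => if φ b = φ (g ω) then (1 : ℝ) else 0

/-- The conditional mean given a finer statistic is a density relative to a coarser one. -/
theorem sum_condLaw_mul_condMean_div_le_one (hp : ∀ ω, 0 ≤ p ω) (h : Ω → ℝ)
    (g : Ω → β) (φ : β → α) (ω : Ω) :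
    ∑ ω', condLaw p (fun ω => φ (g ω)) ω ω' *
      (condMean p h g ω' / condMean p h (fun ω => φ (g ω)) ω') ≤ 1 := by
  have hcoarse (ω' : Ω) : condLaw p (fun ω => φ (g ω)) ω ω' *
      (condMean p h g ω' / condMean p h (fun ω => φ (g ω)) ω') =
      condLaw p (fun ω => φ (g ω)) ω ω' * condMean p h g ω' /
        condMean p h (fun ω => φ (g ω)) ω := by
    by_cases h0 : condLaw p (fun ω => φ (g ω)) ω ω' = 0
    · simp [h0]
    · rw [condMean_congr p h (eq_of_condLaw_ne_zero h0), mul_div_assoc]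
  simp only [hcoarse, ← Finset.sum_div]
  by_cases hω : law p (fun ω => φ (g ω)) (φ (g ω)) = 0
  · simp [condMean, hω]
  · rw [sum_condLaw_mul_condMean hp h g φ hω]
    exact div_self_le_one _

end Conditioning

theorem sum_prod_mul_resample {I V : Type*} [Fintype I] [DecidableEq I] [Fintype V]
    {q : I → V → ℝ} (i : I) (hq : ∑ v, q i v = 1) (F : (I → V) → ℝ) :
    ∑ C, (∏ j, q j (C j)) * F C =
      ∑ C, (∏ j, q j (C j)) * ∑ v, q i v * F (Function.update C i v) := by
  let swap (z : (I → V) × V) : (I → V) × V := (Function.update z.1 i z.2, z.1 i)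
  have hswap : Function.Involutive swap := fun z => by simp [swap]
  have hmass (C : I → V) (v : V) :
      (∏ j, q j (Function.update C i v j)) * q i (C i) = (∏ j, q j (C j)) * q i v := by
    rw [← Finset.mul_prod_erase _ _ (Finset.mem_univ i),
      ← Finset.mul_prod_erase _ (fun j => q j (C j)) (Finset.mem_univ i), Function.update_self,
      Finset.prod_congr rfl fun j hj => by rw [Function.update_of_ne (Finset.ne_of_mem_erase hj)]]
    ring
  calc ∑ C, (∏ j, q j (C j)) * F C
      = ∑ z : (I → V) × V, (∏ j, q j (z.1 j)) * q i z.2 * F z.1 := by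
        rw [Fintype.sum_prod_type]
        simp only [mul_right_comm _ (q i _), ← Finset.mul_sum, hq, mul_one]
    _ = ∑ z : (I → V) × V, (∏ j, q j (z.1 j)) * q i z.2 * F (Function.update z.1 i z.2) :=
        (Fintype.sum_equiv hswap.toPerm _ _ fun z =>
          congrArg (· * F (Function.update z.1 i z.2)) (hmass z.1 z.2).symm).symm
    _ = ∑ C, (∏ j, q j (C j)) * ∑ v, q i v * F (Function.update C i v) := by
        simp only [Fintype.sum_prod_type, mul_assoc, ← Finset.mul_sum]

section Strategies

variable {ι : Type*} [DecidableEq ι] {X : ι → Type*} {A : ℕ → Finset ι} {N : ℕ}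

/-- The letters of the random code: a letter of level `k` chooses the inputs outside `A (k + 1)`
as a function of the inputs chosen by the higher levels.  Superposition of the levels by means of
such maps makes dependent inputs out of independent letters. -/
abbrev Strategy (X : ι → Type*) : Type _ := (∀ i, X i) → ∀ i, X i

/-- The input tuple after the letters of the levels `N, …, k` have been applied to `x₀` in turn;
the letter of level `k` leaves the coordinates in `A (k + 1)` unchanged. -/
def stage (A : ℕ → Finset ι) (x₀ : ∀ i, X i) (v : Fin (N + 1) → Strategy X) (k : ℕ) : ∀ i, X i :=
  if h : k < N + 1 then
    (A (k + 1)).piecewise (stage A x₀ v (k + 1)) (v ⟨k, h⟩ (stage A x₀ v (k + 1)))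
  else x₀
termination_by N + 1 - k

variable {x₀ : ∀ i, X i}

theorem stage_of_lt (v : Fin (N + 1) → Strategy X) {k : ℕ} (h : k < N + 1) :
    stage A x₀ v k =
      (A (k + 1)).piecewise (stage A x₀ v (k + 1)) (v ⟨k, h⟩ (stage A x₀ v (k + 1))) := by
  rw [stage, dif_pos h]

theorem stage_of_le (v : Fin (N + 1) → Strategy X) {k : ℕ} (h : N + 1 ≤ k) :
    stage A x₀ v k = x₀ := by
  rw [stage, dif_neg h.not_gt]

theorem stage_congr {v v' : Fin (N + 1) → Strategy X} (k : ℕ)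
    (h : ∀ i : Fin (N + 1), k ≤ i → v i = v' i) : stage A x₀ v k = stage A x₀ v' k := by
  rcases lt_or_ge k (N + 1) with hk | hk
  · rw [stage_of_lt v hk, stage_of_lt v' hk, h ⟨k, hk⟩ le_rfl,
      stage_congr (k + 1) fun i hi => h i (by omega)]
  · rw [stage_of_le v hk, stage_of_le v' hk]
termination_by N + 1 - k

theorem stage_apply_of_mem (hA : Antitone A) (v : Fin (N + 1) → Strategy X) {k l : ℕ}
    (hkl : k ≤ l) {i : ι} (hi : i ∈ A l) : stage A x₀ v k i = stage A x₀ v l i := by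
  induction hkl using Nat.decreasingInduction with
  | self => rfl
  | of_succ k hk ih =>
    rw [← ih]
    rcases lt_or_ge k (N + 1) with h | h
    · rw [stage_of_lt v h, Finset.piecewise_eq_of_mem _ _ _ (hA hk hi)]
    · rw [stage_of_le v h, stage_of_le v (h.trans k.le_succ)]

/-- The channel inputs: those outside `A 0` come from the letter of the top level alone. -/
def inputOf (A : ℕ → Finset ι) (x₀ : ∀ i, X i) (v : Fin (N + 1) → Strategy X) : ∀ i, X i :=
  (A 0).piecewise (stage A x₀ v 0) (stage A x₀ v N)

theorem restrict_stage (hA : Antitone A) (v : Fin (N + 1) → Strategy X) {k l : ℕ} (hkl : k ≤ l) :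
    (A l).restrict (stage A x₀ v k) = (A l).restrict (inputOf A x₀ v) := by
  funext ⟨i, hi⟩
  simp only [Finset.restrict, inputOf, Finset.piecewise_eq_of_mem _ _ _ (hA l.zero_le hi),
    stage_apply_of_mem hA v hkl hi, stage_apply_of_mem hA v l.zero_le hi]

variable [Fintype ι] [∀ i, Fintype (X i)] {p : (∀ i, X i) → ℝ}

/-- The law of the letters of level `k`: given the tuple `x` made by the higher levels, the
new tuple has the conditional law `p(· | x_{A (k + 1)})`, independently over `x`. -/
noncomputable def strategyLaw (p : (∀ i, X i) → ℝ) (A : ℕ → Finset ι) (k : ℕ)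
    (v : Strategy X) : ℝ :=
  ∏ x, condLaw p (A (k + 1)).restrict x (v x)

theorem strategyLaw_nonneg (hp : ∀ x, 0 ≤ p x) (k : ℕ) (v : Strategy X) :
    0 ≤ strategyLaw p A k v :=
  Finset.prod_nonneg fun x _ => condLaw_nonneg hp _ x (v x)

theorem sum_mul_piecewise {s : Finset ι}
    (hs : ∀ x, p x = law p s.restrict (s.restrict x) * law p sᶜ.restrict (sᶜ.restrict x))
    (F : (∀ i, X i) → ℝ) :
    ∑ z, p z * ∑ x, p x * F (s.piecewise x z) = ∑ x, p x * F x := by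
  classical
  have hpiece (x z w : ∀ i, X i) : s.piecewise x z = w ↔
      s.restrict x = s.restrict w ∧ sᶜ.restrict z = sᶜ.restrict w := by
    simp only [funext_iff, Finset.restrict, Subtype.forall, Finset.mem_compl, ← forall_and]
    exact forall_congr' fun i => by by_cases hi : i ∈ s <;> simp [hi]
  have hprod (w : ∀ i, X i) :
      p w = ∑ z, ∑ x, if s.piecewise x z = w then p z * p x else 0 := by
    rw [hs, mul_comm, law, law, Finset.sum_mul_sum]
    refine Finset.sum_congr rfl fun z _ => Finset.sum_congr rfl fun x _ => ?_
    simp only [hpiece]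
    split_ifs <;> simp_all
  simp only [Finset.mul_sum]
  symm
  calc ∑ w, p w * F w
      = ∑ w, ∑ z, ∑ x, if s.piecewise x z = w then p z * p x * F w else 0 := by
        refine Finset.sum_congr rfl fun w _ => ?_
        conv_lhs => rw [hprod w]
        simp only [Finset.sum_mul, ite_mul, zero_mul]
    _ = ∑ z, ∑ x, p z * (p x * F (s.piecewise x z)) := by
        rw [Finset.sum_comm]
        refine Finset.sum_congr rfl fun z _ => ?_
        rw [Finset.sum_comm]
        simp [mul_assoc]

variable [∀ i, DecidableEq (X i)]

theorem sum_strategyLaw (p : (∀ i, X i) → ℝ) (A : ℕ → Finset ι) (k : ℕ) :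
    ∑ v, strategyLaw p A k v = 1 :=
  sum_prod_eq_one fun x => sum_condLaw p _ x

theorem sum_strategyLaw_mul_apply (k : ℕ) (x : ∀ i, X i) (F : (∀ i, X i) → ℝ) :
    ∑ v, strategyLaw p A k v * F (v x) = ∑ x', condLaw p (A (k + 1)).restrict x x' * F x' := by
  simpa [strategyLaw] using sum_prod_mul_prod_comp (fun x => sum_condLaw p (A (k + 1)).restrict x)
    (Function.injective_of_subsingleton fun _ : Unit => x) fun _ => F

theorem sum_strategyLaw_mul_stage_update {k : ℕ} (hk : k < N + 1) (v : Fin (N + 1) → Strategy X)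
    (F : (∀ i, X i) → ℝ) :
    ∑ a, strategyLaw p A k a * F (stage A x₀ (Function.update v ⟨k, hk⟩ a) k) =
      ∑ x, condLaw p (A (k + 1)).restrict (stage A x₀ v (k + 1)) x * F x := by
  have hstage (a : Strategy X) : stage A x₀ (Function.update v ⟨k, hk⟩ a) k =
      (A (k + 1)).piecewise (stage A x₀ v (k + 1)) (a (stage A x₀ v (k + 1))) := by
    rw [stage_of_lt _ hk, Function.update_self, stage_congr (k + 1) fun i hi =>
      Function.update_of_ne (Fin.ne_of_val_ne (by simp; omega)) a v]
  simp only [hstage]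
  rw [sum_strategyLaw_mul_apply k (stage A x₀ v (k + 1)) fun x =>
    F ((A (k + 1)).piecewise (stage A x₀ v (k + 1)) x)]
  refine Finset.sum_congr rfl fun x _ => ?_
  by_cases hx : condLaw p (A (k + 1)).restrict (stage A x₀ v (k + 1)) x = 0
  · rw [hx, zero_mul, zero_mul]
  · congr 2
    funext i
    by_cases hi : i ∈ A (k + 1)
    · simpa [hi] using (congrFun (eq_of_condLaw_ne_zero hx) ⟨i, hi⟩).symm
    · simp [hi]

theorem sum_prod_strategyLaw_mul_stage {k : ℕ} (hk : k < N + 1)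
    (G : (∀ i, X i) → (Fin (N + 1) → Strategy X) → ℝ)
    (hG : ∀ x v b, G x (Function.update v ⟨k, hk⟩ b) = G x v) :
    ∑ v, (∏ i : Fin (N + 1), strategyLaw p A i (v i)) * G (stage A x₀ v k) v =
      ∑ v, (∏ i : Fin (N + 1), strategyLaw p A i (v i)) *
        ∑ x, condLaw p (A (k + 1)).restrict (stage A x₀ v (k + 1)) x * G x v := by
  rw [sum_prod_mul_resample ⟨k, hk⟩ (sum_strategyLaw p A k)]
  refine Finset.sum_congr rfl fun v _ => congrArg (_ * ·) ?_
  simp only [hG]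
  exact sum_strategyLaw_mul_stage_update hk v fun x => G x v

theorem sum_prod_strategyLaw_mul_stage_last (hp : p ∈ stdSimplex ℝ (∀ i, X i))
    (hA : A (N + 1) = ∅) (F : (∀ i, X i) → ℝ) :
    ∑ v, (∏ i : Fin (N + 1), strategyLaw p A i (v i)) * F (stage A x₀ v N) = ∑ x, p x * F x := by
  rw [sum_prod_strategyLaw_mul_stage N.lt_succ_self (fun x _ => F x) fun _ _ _ => rfl]
  have : IsEmpty (A (N + 1)) := Finset.isEmpty_coe_sort.2 hA
  simp only [condLaw_of_subsingleton hp.2]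
  rw [← Finset.sum_mul, sum_prod_eq_one (q := fun i : Fin (N + 1) => strategyLaw p A i)
    fun i => sum_strategyLaw p A i, one_mul]

theorem sum_prod_strategyLaw_mul_stage_pair (hp : p ∈ stdSimplex ℝ (∀ i, X i))
    (hA : Antitone A) (hAN : A N = ∅) {k : ℕ} (hk : k < N) (F : (∀ i, X i) → (∀ i, X i) → ℝ) :
    ∑ v, (∏ i : Fin (N + 1), strategyLaw p A i (v i)) * F (stage A x₀ v k) (stage A x₀ v N) =
      ∑ z, p z * ∑ x, p x * F x z := by
  have hstep {k : ℕ} (hk : k < N) (F : (∀ i, X i) → (∀ i, X i) → ℝ) :=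
    sum_prod_strategyLaw_mul_stage (p := p) (A := A) (x₀ := x₀) (hk.trans N.lt_succ_self)
      (fun x v => F x (stage A x₀ v N)) fun x v b => by
        rw [stage_congr N fun i hi => Function.update_of_ne (Fin.ne_of_val_ne (by simp; omega)) b v]
  induction Nat.le_sub_one_of_lt hk using Nat.decreasingInduction generalizing F with
  | self =>
    have : IsEmpty (A (N - 1 + 1)) :=
      Finset.isEmpty_coe_sort.2 (by rw [Nat.sub_add_cancel (by omega), hAN])
    rw [hstep (by omega)]
    simp only [condLaw_of_subsingleton hp.2]
    exact sum_prod_strategyLaw_mul_stage_last hp (Finset.subset_empty.1 (hAN ▸ hA N.le_succ))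
      fun z => ∑ x, p x * F x z
  | of_succ k hk' ih =>
    rw [hstep (by omega), ih (by omega) fun x z =>
      ∑ x', condLaw p (A (k + 1)).restrict x x' * F x' z]
    simp only [sum_mul_condLaw_mul hp.1]

theorem sum_prod_strategyLaw_mul_inputOf (hp : p ∈ stdSimplex ℝ (∀ i, X i))
    (hA : Antitone A) (hAN : A N = ∅) (hN : 0 < N)
    (hind : ∀ x, p x =
      law p (A 0).restrict ((A 0).restrict x) * law p (A 0)ᶜ.restrict ((A 0)ᶜ.restrict x))
    (F : (∀ i, X i) → ℝ) :
    ∑ v, (∏ i : Fin (N + 1), strategyLaw p A i (v i)) * F (inputOf A x₀ v) = ∑ x, p x * F x :=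
  (sum_prod_strategyLaw_mul_stage_pair hp hA hAN hN fun x z => F ((A 0).piecewise x z)).trans
    (sum_mul_piecewise hind F)

end Strategies

section Successive

variable {M : Type*} [Inhabited M]

/-- Successive decoding: the estimate of block `b` is some message that passes the test `P b`, which
is given the estimates of the previous blocks. -/
noncomputable def successive (P : ℕ → (ℕ → M) → M → Prop) : ℕ → ℕ → M
  | 0 => default
  | b + 1 => Function.update (successive P b) b (Classical.epsilon (P b (successive P b)))

theorem successive_congr {P P' : ℕ → (ℕ → M) → M → Prop} (b : ℕ) (h : ∀ b' < b, P b' = P' b') :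
    successive P b = successive P' b := by
  induction b with
  | zero => rfl
  | succ b ih =>
    rw [successive, successive, ih fun b' hb' => h b' (hb'.trans b.lt_succ_self),
      h b b.lt_succ_self]

theorem successive_apply {P : ℕ → (ℕ → M) → M → Prop} {w : ℕ → M} {B : ℕ}
    (hc : ∀ b w w', (∀ b' < b, w b' = w' b') → P b w = P b w')
    (hP : ∀ b < B, ∀ x, P b w x ↔ x = w b) {b : ℕ} (hb : b ≤ B) (b' : ℕ) :
    successive P b b' = if b' < b then w b' else default := by
  induction b generalizing b' with
  | zero => rfl
  | succ b ih =>
    have htest : P b (successive P b) = P b w :=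
      hc b _ _ fun b' hb' => by rw [ih (b.le_succ.trans hb), if_pos hb']
    have hdec : Classical.epsilon (P b w) = w b :=
      (hP b hb _).1 (Classical.epsilon_spec ⟨w b, (hP b hb _).2 rfl⟩)
    rcases eq_or_ne b' b with rfl | hne
    · simp [successive, htest, hdec]
    · rw [successive, Function.update_of_ne hne, ih (b.le_succ.trans hb)]
      simp only [Nat.lt_succ_iff, hne.le_iff_lt]

end Successive

section Blocks

/-- The `b`-th block of a sequence of `B` blocks of length `m`; constant beyond the last block. -/
def block {α : Type*} [Inhabited α] {B m : ℕ} (s : Fin (B * m) → α) (b : ℕ) : Fin m → α :=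
  if h : b < B then fun j => s (finProdFinEquiv (⟨b, h⟩, j)) else default

theorem block_of_lt {α : Type*} [Inhabited α] {B m b : ℕ} (s : Fin (B * m) → α) (hb : b < B) :
    block s b = fun j => s (finProdFinEquiv (⟨b, hb⟩, j)) :=
  dif_pos hb

theorem block_of_le {α : Type*} [Inhabited α] {B m b : ℕ} (s : Fin (B * m) → α) (hb : B ≤ b) :
    block s b = default :=
  dif_neg hb.not_gt

/-- Extend a sequence of past symbols by a constant. -/
def extend {α : Type*} [Inhabited α] {t : ℕ} (T : ℕ) (y : Fin t → α) : Fin T → α :=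
  fun u => if h : u < t then y ⟨u, h⟩ else default

/-- The message carried by level `l` in the channel block `β`: the source block `β - l`.  Level `N`
carries no message. -/
def levelMsg {M : Type*} [Inhabited M] (N : ℕ) (w : ℕ → M) (β : ℕ) (l : Fin (N + 1)) : M :=
  if l < N ∧ l ≤ β then w (β - l) else default

theorem levelMsg_add {M : Type*} [Inhabited M] {N : ℕ} (w : ℕ → M) (b : ℕ) {k : Fin (N + 1)}
    (hk : k < N) : levelMsg N w (b + k) k = w b := by
  rw [levelMsg, if_pos ⟨hk, Nat.le_add_left _ _⟩, Nat.add_sub_cancel]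

theorem levelMsg_update {M : Type*} [Inhabited M] {N : ℕ} (w : ℕ → M) (b : ℕ) (c : M)
    {k : Fin (N + 1)} (hk : k < N) :
    levelMsg N (Function.update w b c) (b + k) =
      Function.update (levelMsg N w (b + k)) k c := by
  funext l
  rcases eq_or_ne l k with rfl | hne
  · simp [levelMsg_add _ _ hk]
  · have hval : (l : ℕ) ≠ k := Fin.val_ne_of_ne hne
    rw [Function.update_of_ne hne, levelMsg, levelMsg]
    split_ifs with h
    · rw [Function.update_of_ne (by omega)]
    · rfl

/-- A codebook has a letter for each of `T` times, each level and each message. -/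
abbrev Codebook (M V : Type*) (N T : ℕ) : Type _ := Fin T → Fin (N + 1) × M → V

/-- The letters of all levels at time `t`, with channel blocks of length `n`, when the message of
the source block `b` is `w b`. -/
def word {M V : Type*} [Inhabited M] {N T : ℕ} (n : ℕ) (C : Codebook M V N T) (w : ℕ → M)
    (t : Fin T) : Fin (N + 1) → V :=
  fun l => C t (l, levelMsg N w (t / n) l)

end Blocks

section Code

variable {K : ℕ} {S : Fin (K + 2) → Type*} {X Y : Fin (K + 1) → Type*} {m n : ℕ}

theorem Code.input_congr (c : Code S X Y m n) (s : Fin m → ∀ i, S i) {y y' : Fin n → ∀ v, Y v}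
    {t : Fin n} (h : ∀ u < t, y u = y' u) : c.input s y t = c.input s y' t := by
  funext j
  cases j using Fin.cases with
  | zero => rfl
  | succ k =>
    exact congrArg (c.relay k t · fun l => s l k.succ.castSucc) <| funext fun u =>
      congrFun (h (Fin.castLE t.2.le u) u.2) k.castSucc

variable [∀ v, Fintype (Y v)] {pS : (∀ i, S i) → ℝ} {W : (∀ j, X j) → (∀ v, Y v) → ℝ}

theorem Code.sum_prob [∀ v, Nonempty (Y v)] (hW : ∀ x, W x ∈ stdSimplex ℝ (∀ v, Y v))
    (c : Code S X Y m n) (s : Fin m → ∀ i, S i) : ∑ y, c.prob pS W s y = ∏ l, pS (s l) := by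
  classical
  simp only [Code.prob, ← Finset.mul_sum]
  rw [sum_prod_causal (fun t y => W (c.input s y t)) (fun t y => (hW _).2)
    fun t y y' h => by rw [c.input_congr s h], mul_one]

variable [∀ i, Fintype (S i)]

theorem Code.prob_nonneg (hpS : pS ∈ stdSimplex ℝ (∀ i, S i))
    (hW : ∀ x, W x ∈ stdSimplex ℝ (∀ v, Y v)) (c : Code S X Y m n) (s : Fin m → ∀ i, S i)
    (y : Fin n → ∀ v, Y v) : 0 ≤ c.prob pS W s y :=
  mul_nonneg (Finset.prod_nonneg fun _ _ => hpS.1 _) (Finset.prod_nonneg fun _ _ => (hW _).1 _)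

theorem Code.errorProb_nonneg (hpS : pS ∈ stdSimplex ℝ (∀ i, S i))
    (hW : ∀ x, W x ∈ stdSimplex ℝ (∀ v, Y v)) (c : Code S X Y m n) : 0 ≤ c.errorProb pS W := by
  refine Finset.sum_nonneg fun s _ => Finset.sum_nonneg fun y _ => ?_
  split_ifs
  exacts [c.prob_nonneg hpS hW s y, le_rfl]

end Code

section Scheme

variable {K : ℕ}

/-- A decode-and-forward scheme with the levels `0, …, N`.  A terminal of level `i` knows the
letters of the levels `≥ i`.  The receiver `u` (terminal `u + 1`) ranks candidate source blocks by
the product of `sideScore` over the side information and of `chanScore` over a window of channel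
blocks, in the `k`-th of which the candidate is carried by level `k`. -/
structure Scheme (S : Fin (K + 2) → Type*) (X Y : Fin (K + 1) → Type*) (N : ℕ) (V : Type*) where
  /-- the law of the letters of each level -/
  letterLaw : Fin (N + 1) → V → ℝ
  /-- the channel inputs as functions of the letters of all levels -/
  inputMap : (Fin (N + 1) → V) → ∀ j, X j
  /-- the level of each terminal -/
  level : Fin (K + 2) → Fin (N + 1)
  level_last : level (Fin.last (K + 1)) = Fin.last N
  inputMap_congr : ∀ (j : Fin (K + 1)) v v',
    (∀ l, level j.castSucc ≤ l → v l = v' l) → inputMap v j = inputMap v' j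
  /-- the score of a source symbol, given a symbol of the side information -/
  sideScore : ∀ u : Fin (K + 1), S 0 → S u.succ → ℝ
  /-- the score of the letter of level `k`, given the letters of higher levels and an output -/
  chanScore : ∀ u : Fin (K + 1), ℕ → (Fin (N + 1) → V) → Y u → ℝ
  chanScore_congr : ∀ u (k : ℕ) v v' y,
    (∀ l : Fin (N + 1), k ≤ l → v l = v' l) → chanScore u k v y = chanScore u k v' y

variable {S : Fin (K + 2) → Type*} {X Y : Fin (K + 1) → Type*} {N : ℕ} {V : Type*}

namespace Scheme

variable (A : Scheme S X Y N V)

/-- The receivers that have to decode: the destination and the cooperating relays. -/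
def Active (u : Fin (K + 1)) : Prop := u = Fin.last K ∨ A.level u.succ < Fin.last N

/-- The score of the letters `v` in the channel block `β`, as a contribution to the score of a
candidate for the source block `b`. -/
def slotScore (u : Fin (K + 1)) (b β : ℕ) (v : Fin (N + 1) → V) (y : Y u) : ℝ :=
  if b ≤ β ∧ β < b + A.level u.succ then A.chanScore u (β - b) v y else 1

variable [∀ i, Inhabited (S i)] {B m n T : ℕ}

/-- The score of the candidate `c` for the source block `b`, given the side information `σ`, the
outputs `y` and the other source blocks `w`. -/
noncomputable def score (n : ℕ) (C : Codebook (Fin m → S 0) V N T) (u : Fin (K + 1))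
    (σ : ℕ → Fin m → S u.succ) (y : Fin T → Y u) (b : ℕ) (w : ℕ → Fin m → S 0)
    (c : Fin m → S 0) : ℝ :=
  (∏ j, A.sideScore u (c j) (σ b j)) *
    ∏ t : Fin T, A.slotScore u b (t / n) (word n C (Function.update w b c) t) (y t)

theorem score_congr_blocks (C : Codebook (Fin m → S 0) V N T) (u : Fin (K + 1))
    (σ : ℕ → Fin m → S u.succ) (y : Fin T → Y u) (b : ℕ) {w w' : ℕ → Fin m → S 0}
    (h : ∀ b' < b, w b' = w' b') : A.score n C u σ y b w = A.score n C u σ y b w' := by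
  funext c
  refine congrArg (HMul.hMul _) (Finset.prod_congr rfl fun t _ => ?_)
  unfold slotScore
  split_ifs with ht
  · refine A.chanScore_congr _ _ _ _ _ fun l hl => congrArg (fun c => C t (l, c)) ?_
    unfold levelMsg
    split_ifs
    · rcases eq_or_ne (t / n - l : ℕ) b with e | e
      · simp only [e, Function.update_self]
      · rw [Function.update_of_ne e, Function.update_of_ne e, h _ (by omega)]
    · rfl
  · rfl

theorem score_congr_outputs (C : Codebook (Fin m → S 0) V N T) (u : Fin (K + 1))
    (σ : ℕ → Fin m → S u.succ) {y y' : Fin T → Y u} (b : ℕ)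
    (h : ∀ t : Fin T, t / n < b + A.level u.succ → y t = y' t) :
    A.score n C u σ y b = A.score n C u σ y' b := by
  funext w c
  refine congrArg (HMul.hMul _) (Finset.prod_congr rfl fun t _ => ?_)
  unfold slotScore
  split_ifs with ht
  · rw [h t ht.2]
  · rfl

variable (θ : ℝ)

/-- The estimates of the first `b` source blocks at the receiver `u`, which accepts the candidates
of score at least `θ`. -/
noncomputable def estimate (n : ℕ) (C : Codebook (Fin m → S 0) V N T) (u : Fin (K + 1))
    (s : Fin (B * m) → S u.succ) (y : Fin T → Y u) (b : ℕ) : ℕ → Fin m → S 0 :=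
  successive (fun b w c => θ ≤ A.score n C u (block s) y b w c) b

theorem estimate_congr (C : Codebook (Fin m → S 0) V N T) (u : Fin (K + 1))
    (s : Fin (B * m) → S u.succ) {y y' : Fin T → Y u} (b : ℕ)
    (h : ∀ t : Fin T, t / n + 1 < b + A.level u.succ → y t = y' t) :
    A.estimate θ n C u s y b = A.estimate θ n C u s y' b :=
  successive_congr b fun b' hb' => by
    rw [A.score_congr_outputs C u (block s) b' fun t ht => h t (by omega)]

variable (C : Codebook (Fin m → S 0) V N ((B + N) * n))

/-- The score of a candidate for the source block `b` at a receiver who knows the other blocks. -/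
noncomputable def genieScore (u : Fin (K + 1)) (b : ℕ) (s : Fin (B * m) → ∀ i, S i)
    (y : Fin ((B + N) * n) → ∀ v, Y v) (c : Fin m → S 0) : ℝ :=
  A.score n C u (block fun l => s l u.succ) (fun t => y t u) b (block fun l => s l 0) c

/-- Every receiver that has to decode accepts exactly the true source blocks. -/
def Good (s : Fin (B * m) → ∀ i, S i) (y : Fin ((B + N) * n) → ∀ v, Y v) : Prop :=
  ∀ u, A.Active u → ∀ b < B, ∀ c,
    θ ≤ A.genieScore C u b s y c ↔ c = block (fun l => s l 0) b

variable {A C θ} {s : Fin (B * m) → ∀ i, S i} {y : Fin ((B + N) * n) → ∀ v, Y v}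

theorem Good.estimate_apply (h : A.Good θ C s y) {u : Fin (K + 1)} (hu : A.Active u) {b : ℕ}
    (hb : b ≤ B) (b' : ℕ) :
    A.estimate θ n C u (fun l => s l u.succ) (fun t => y t u) b b' =
      if b' < b then block (fun l => s l 0) b' else default :=
  successive_apply (fun b w w' hw => by rw [A.score_congr_blocks C u _ _ b hw]) (h u hu) hb b'

variable [∀ v, Inhabited (Y v)]

variable (A θ C) in
/-- The code of the scheme with codebook `C` and threshold `θ`. A relay of level `i` knows the
source block `b` after the channel block `b + i - 1`. -/
noncomputable def code : Code S X Y (B * m) ((B + N) * n) where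
  enc s t := A.inputMap (word n C (block s) t) 0
  relay k t y s := A.inputMap (word n C (A.estimate θ n C k.castSucc s (extend _ y)
    (min B (t / n + 1 - A.level k.castSucc.succ))) t) k.succ
  dec y s l := A.estimate θ n C (Fin.last K) s y B (finProdFinEquiv.symm l).1
    (finProdFinEquiv.symm l).2

theorem Good.input_eq (h : A.Good θ C s y) (t : Fin ((B + N) * n)) :
    (A.code θ C).input s y t = A.inputMap (word n C (block fun l => s l 0) t) := by
  funext j
  cases j using Fin.cases with
  | zero => rfl
  | succ k =>
    refine A.inputMap_congr k.succ _ _ fun l (hl : A.level k.castSucc.succ ≤ l) =>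
      congrArg (fun c => C t (l, c)) ?_
    unfold levelMsg
    split_ifs with hlN
    · have hpast : A.estimate θ n C k.castSucc (fun l => s l k.castSucc.succ)
          (extend _ fun u : Fin t => y (Fin.castLE t.2.le u) k.castSucc)
          (min B (t / n + 1 - A.level k.castSucc.succ)) =
          A.estimate θ n C k.castSucc (fun l => s l k.castSucc.succ) (fun t => y t k.castSucc)
            (min B (t / n + 1 - A.level k.castSucc.succ)) := by
        refine A.estimate_congr θ C _ _ _ fun u hu => dif_pos ?_
        by_contra! htu
        have := Nat.div_le_div_right (c := n) htu
        omega
      refine (congrFun hpast _).trans ((h.estimate_apply (Or.inr (hl.trans_lt hlN.1))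
        (min_le_left _ _) _).trans ?_)
      split_ifs with hB
      · rfl
      · rw [block_of_le]
        omega
    · rfl

theorem Good.dec_eq (h : A.Good θ C s y) :
    (A.code θ C).dec (fun t => y t (Fin.last K)) (fun l => s l (Fin.last (K + 1))) =
      fun l => s l 0 := by
  funext l
  refine (congrFun (h.estimate_apply (Or.inl rfl) le_rfl _) _).trans ?_
  rw [if_pos (Fin.is_lt _), block_of_lt _ (Fin.is_lt _)]
  exact congrArg (s · 0) (finProdFinEquiv.apply_symm_apply l)

end Scheme

end Scheme

section TimeBlocks

theorem prod_time_blocks (L n : ℕ) (g : ℕ → ℝ) :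
    ∏ t : Fin (L * n), g (t / n) = ∏ β ∈ Finset.range L, g β ^ n := by
  rw [← finProdFinEquiv.prod_comp, Fintype.prod_prod_type, Finset.prod_range]
  refine Finset.prod_congr rfl fun β _ => ?_
  rw [← Fin.prod_const]
  refine Finset.prod_congr rfl fun j _ => congrArg g ?_
  have hj : (finProdFinEquiv (β, j) : ℕ) = j + n * β := rfl
  rw [hj, Nat.add_mul_div_left _ _ j.pos, Nat.div_eq_of_lt j.2, zero_add]

theorem prod_window {L n b i : ℕ} (h : b + i ≤ L) (g : ℕ → ℝ) :
    ∏ t : Fin (L * n), (if b ≤ t / n ∧ t / n < b + i then g (t / n - b) else 1) =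
      (∏ k ∈ Finset.range i, g k) ^ n := by
  rw [prod_time_blocks L n fun β => if b ≤ β ∧ β < b + i then g (β - b) else 1,
    Finset.prod_pow, ← Finset.prod_filter]
  have hwindow : {β ∈ Finset.range L | b ≤ β ∧ β < b + i} = Finset.Ico b (b + i) := by
    ext β
    simp only [Finset.mem_filter, Finset.mem_range, Finset.mem_Ico]
    omega
  rw [hwindow, Finset.prod_Ico_eq_prod_range, Nat.add_sub_cancel_left]
  simp only [Nat.add_sub_cancel_left]

end TimeBlocks

section ThresholdLoss

variable {M : Type*} [Fintype M] [DecidableEq M] {θ lam : ℝ} {f : M → ℝ} {w : M}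

/-- A bound on the indicator that the test `θ ≤ f c` does not single out `c = w`: the true
candidate is controlled by a negative moment of its score, the others by their mean scores. -/
noncomputable def thresholdLoss (θ lam : ℝ) (f : M → ℝ) (w : M) : ℝ :=
  θ ^ lam * f w ^ (-lam) + (∑ c ∈ Finset.univ.erase w, f c) / θ

theorem thresholdLoss_nonneg (hθ : 0 ≤ θ) (hf : ∀ c, 0 ≤ f c) : 0 ≤ thresholdLoss θ lam f w :=
  add_nonneg (mul_nonneg (Real.rpow_nonneg hθ _) (Real.rpow_nonneg (hf w) _))
    (div_nonneg (Finset.sum_nonneg fun c _ => hf c) hθ)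

theorem one_le_thresholdLoss (hθ : 0 < θ) (hlam : 0 ≤ lam) (hf : ∀ c, 0 ≤ f c) (hw : 0 < f w)
    (h : ¬ ∀ c, θ ≤ f c ↔ c = w) : 1 ≤ thresholdLoss θ lam f w := by
  have htrue : 0 ≤ θ ^ lam * f w ^ (-lam) :=
    mul_nonneg (Real.rpow_nonneg hθ.le _) (Real.rpow_nonneg hw.le _)
  have hwrong : 0 ≤ (∑ c ∈ Finset.univ.erase w, f c) / θ :=
    div_nonneg (Finset.sum_nonneg fun c _ => hf c) hθ.le
  rcases lt_or_ge (f w) θ with hlt | hge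
  · have : 1 ≤ θ ^ lam * f w ^ (-lam) := by
      rw [Real.rpow_neg hw.le, ← div_eq_mul_inv, ← Real.div_rpow hθ.le hw.le]
      exact Real.one_le_rpow ((one_le_div hw).2 hlt.le) hlam
    exact this.trans (le_add_of_nonneg_right hwrong)
  · obtain ⟨c, hc, hcw⟩ : ∃ c, θ ≤ f c ∧ c ≠ w := by
      by_contra! hall
      exact h fun c => ⟨hall c, fun hc => hc ▸ hge⟩
    have : 1 ≤ (∑ c ∈ Finset.univ.erase w, f c) / θ := by
      rw [one_le_div hθ]
      exact hc.trans (Finset.single_le_sum (fun c _ => hf c)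
        (Finset.mem_erase.2 ⟨hcw, Finset.mem_univ c⟩))
    exact this.trans (le_add_of_nonneg_left htrue)

end ThresholdLoss

namespace Scheme

section RandomCoding

variable {K : ℕ} {S : Fin (K + 2) → Type*} {X Y : Fin (K + 1) → Type*} {N : ℕ} {V : Type*}
  {A : Scheme S X Y N V}

theorem Active.level_le {u : Fin (K + 1)} (hu : A.Active u) : A.level u.succ ≤ N := by
  rcases hu with rfl | h
  · exact A.level_last.le
  · exact h.le

/-- The joint law of the letters of all levels and the channel outputs. -/
def letterOutputLaw (A : Scheme S X Y N V) (W : (∀ j, X j) → (∀ v, Y v) → ℝ) :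
    (Fin (N + 1) → V) × (∀ v, Y v) → ℝ :=
  fun p => (∏ l, A.letterLaw l (p.1 l)) * W (A.inputMap p.1) p.2

variable [Fintype V] [∀ i, Fintype (S i)] [DecidableEq (S 0)] [∀ v, Fintype (Y v)]

/-- The conditions on the scores under which a random codebook succeeds with `r` source symbols
per channel use: a wrong candidate has mean score at most its side score, the side scores of the
wrong candidates sum to at most one, and the expected logarithm of the score of the true candidate
is positive. -/
structure Valid (A : Scheme S X Y N V) (pS : (∀ i, S i) → ℝ)
    (W : (∀ j, X j) → (∀ v, Y v) → ℝ) (r : ℝ) : Prop where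
  letterLaw_nonneg : ∀ l v, 0 ≤ A.letterLaw l v
  sum_letterLaw : ∀ l, ∑ v, A.letterLaw l v = 1
  sideScore_nonneg : ∀ u c σ, 0 ≤ A.sideScore u c σ
  sideScore_pos : ∀ u, A.Active u → ∀ s, 0 < pS s → 0 < A.sideScore u (s 0) (s u.succ)
  sum_sideScore_le : ∀ u, A.Active u → ∀ (m : ℕ) (s : Fin m → ∀ i, S i), (∀ l, 0 < pS (s l)) →
    ∑ c ∈ Finset.univ.erase (fun l => s l 0), ∏ l, A.sideScore u (c l) (s l u.succ) ≤ 1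
  chanScore_nonneg : ∀ u k v y, 0 ≤ A.chanScore u k v y
  chanScore_pos : ∀ u, A.Active u → ∀ k < (A.level u.succ : ℕ), ∀ p,
    0 < A.letterOutputLaw W p → 0 < A.chanScore u k p.1 (p.2 u)
  sum_chanScore_le : ∀ u, A.Active u → ∀ k < A.level u.succ, ∀ v y,
    ∑ a, A.letterLaw k a * A.chanScore u k (Function.update v k a) y ≤ 1
  drift_pos : ∀ u, A.Active u → 0 < r * ∑ s, pS s * Real.log (A.sideScore u (s 0) (s u.succ)) +
    ∑ k ∈ Finset.range (A.level u.succ),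
      ∑ p, A.letterOutputLaw W p * Real.log (A.chanScore u k p.1 (p.2 u))

end RandomCoding

end Scheme

namespace Scheme

section Ensemble

variable {K : ℕ} {S : Fin (K + 2) → Type*} {X Y : Fin (K + 1) → Type*} {N : ℕ} {V : Type*}

/-- The probability of a random codebook, whose letters are independent. -/
def bookLaw (A : Scheme S X Y N V) {M : Type*} [Fintype M] {T : ℕ} (C : Codebook M V N T) : ℝ :=
  ∏ t, ∏ i, A.letterLaw i.1 (C t i)

/-- The joint probability of a random codebook and the channel outputs, when the message of each
source block `b` is `w b` and every terminal knows it in time. -/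
def ensembleLaw (A : Scheme S X Y N V) (W : (∀ j, X j) → (∀ v, Y v) → ℝ) {M : Type*} [Fintype M]
    [Inhabited M] {T : ℕ} (n : ℕ) (w : ℕ → M) (ω : Codebook M V N T × (Fin T → ∀ v, Y v)) : ℝ :=
  A.bookLaw ω.1 * ∏ t, W (A.inputMap (word n ω.1 w t)) (ω.2 t)

theorem sum_ensembleLaw_mul_prod [Fintype V] [∀ v, Fintype (Y v)] (A : Scheme S X Y N V)
    (W : (∀ j, X j) → (∀ v, Y v) → ℝ) {M : Type*} [Fintype M] [DecidableEq M] [Inhabited M]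
    {n T : ℕ} (w : ℕ → M) (G : Fin T → (Fin (N + 1) × M → V) → (∀ v, Y v) → ℝ) :
    ∑ ω, A.ensembleLaw W n w ω * ∏ t, G t (ω.1 t) (ω.2 t) =
      ∏ t : Fin T, ∑ c : Fin (N + 1) × M → V, (∏ i, A.letterLaw i.1 (c i)) *
        ∑ z, W (A.inputMap fun l => c (l, levelMsg N w (t / n) l)) z * G t c z := by
  simp only [Finset.mul_sum, Fintype.prod_sum]
  rw [Fintype.sum_prod_type]
  simp only [ensembleLaw, bookLaw, Finset.prod_mul_distrib, mul_assoc]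
  rfl

variable {A : Scheme S X Y N V} [Fintype V] [∀ i, Fintype (S i)] [DecidableEq (S 0)]
  [∀ v, Fintype (Y v)] {pS : (∀ i, S i) → ℝ} {W : (∀ j, X j) → (∀ v, Y v) → ℝ} {r : ℝ}

namespace Valid

theorem bookLaw_nonneg (hA : A.Valid pS W r) {M : Type*} [Fintype M] {T : ℕ}
    (C : Codebook M V N T) : 0 ≤ A.bookLaw C :=
  Finset.prod_nonneg fun _ _ => Finset.prod_nonneg fun _ _ => hA.letterLaw_nonneg _ _

theorem bookLaw_mem_stdSimplex (hA : A.Valid pS W r) (M : Type*) [Fintype M] [DecidableEq M]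
    (T : ℕ) : A.bookLaw ∈ stdSimplex ℝ (Codebook M V N T) := by
  have hcolumn : ∑ c : Fin (N + 1) × M → V, ∏ i, A.letterLaw i.1 (c i) = 1 :=
    sum_prod_eq_one fun i => hA.sum_letterLaw i.1
  exact ⟨hA.bookLaw_nonneg, sum_prod_eq_one fun _ : Fin T => hcolumn⟩

theorem letterOutputLaw_mem_stdSimplex (hA : A.Valid pS W r)
    (hW : ∀ x, W x ∈ stdSimplex ℝ (∀ v, Y v)) :
    A.letterOutputLaw W ∈ stdSimplex ℝ ((Fin (N + 1) → V) × (∀ v, Y v)) := by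
  refine ⟨fun p => mul_nonneg (Finset.prod_nonneg fun _ _ => hA.letterLaw_nonneg _ _)
    ((hW _).1 _), ?_⟩
  simp only [Fintype.sum_prod_type, letterOutputLaw, ← Finset.mul_sum, (hW _).2, mul_one]
  exact sum_prod_eq_one hA.sum_letterLaw

theorem ensembleLaw_nonneg (hA : A.Valid pS W r) (hW : ∀ x, W x ∈ stdSimplex ℝ (∀ v, Y v))
    {M : Type*} [Fintype M] [Inhabited M] {n T : ℕ} (w : ℕ → M)
    (ω : Codebook M V N T × (Fin T → ∀ v, Y v)) : 0 ≤ A.ensembleLaw W n w ω :=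
  mul_nonneg (hA.bookLaw_nonneg _) (Finset.prod_nonneg fun _ _ => (hW _).1 _)

theorem slotScore_nonneg (hA : A.Valid pS W r) (u : Fin (K + 1)) (b β : ℕ)
    (v : Fin (N + 1) → V) (y : Y u) : 0 ≤ A.slotScore u b β v y := by
  unfold slotScore
  split_ifs
  exacts [hA.chanScore_nonneg _ _ _ _, zero_le_one]

theorem slotScore_pos (hA : A.Valid pS W r) {u : Fin (K + 1)} (hu : A.Active u) (b β : ℕ)
    {p : (Fin (N + 1) → V) × (∀ v, Y v)} (hp : 0 < A.letterOutputLaw W p) :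
    0 < A.slotScore u b β p.1 (p.2 u) := by
  unfold slotScore
  split_ifs
  exacts [hA.chanScore_pos u hu _ (by omega) p hp, zero_lt_one]

variable [∀ i, Inhabited (S i)] {m n T : ℕ}

theorem score_nonneg (hA : A.Valid pS W r) (C : Codebook (Fin m → S 0) V N T) (u : Fin (K + 1))
    (σ : ℕ → Fin m → S u.succ) (y : Fin T → Y u) (b : ℕ) (w : ℕ → Fin m → S 0)
    (c : Fin m → S 0) : 0 ≤ A.score n C u σ y b w c :=
  mul_nonneg (Finset.prod_nonneg fun _ _ => hA.sideScore_nonneg _ _ _)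
    (Finset.prod_nonneg fun _ _ => hA.slotScore_nonneg _ _ _ _ _)

theorem score_pos (hA : A.Valid pS W r) (hW : ∀ x, W x ∈ stdSimplex ℝ (∀ v, Y v))
    {u : Fin (K + 1)} (hu : A.Active u) {b : ℕ} {w : ℕ → Fin m → S 0}
    {σ : ℕ → Fin m → S u.succ} (hside : ∀ j, 0 < A.sideScore u (w b j) (σ b j))
    {ω : Codebook (Fin m → S 0) V N T × (Fin T → ∀ v, Y v)} (hω : A.ensembleLaw W n w ω ≠ 0) :
    0 < A.score n ω.1 u σ (fun t => ω.2 t u) b w (w b) := by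
  refine mul_pos (Finset.prod_pos fun j _ => hside j) (Finset.prod_pos fun t _ => ?_)
  rw [Function.update_eq_self]
  refine hA.slotScore_pos hu b _ (p := (word n ω.1 w t, ω.2 t))
    (((hA.letterOutputLaw_mem_stdSimplex hW).1 _).lt_of_ne' (mul_ne_zero ?_ ?_))
  · exact Finset.prod_ne_zero_iff.2 fun l _ => Finset.prod_ne_zero_iff.1
      (Finset.prod_ne_zero_iff.1 (left_ne_zero_of_mul hω) t (Finset.mem_univ t))
      (l, levelMsg N w (t / n) l) (Finset.mem_univ _)
  · exact Finset.prod_ne_zero_iff.1 (right_ne_zero_of_mul hω) t (Finset.mem_univ t)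

end Valid

/-- The negative moment of the score that a receiver gets from a column of `level u` uses of the
channel, one for each level below its own. -/
noncomputable def chanMoment (A : Scheme S X Y N V) (W : (∀ j, X j) → (∀ v, Y v) → ℝ)
    (u : Fin (K + 1)) (lam : ℝ) : ℝ :=
  ∏ k ∈ Finset.range (A.level u.succ),
    negMoment (A.letterOutputLaw W) (fun p => A.chanScore u k p.1 (p.2 u)) lam

namespace Valid

theorem negMoment_slotScore (hA : A.Valid pS W r) (hW : ∀ x, W x ∈ stdSimplex ℝ (∀ v, Y v))
    (u : Fin (K + 1)) (b β : ℕ) (lam : ℝ) :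
    negMoment (A.letterOutputLaw W) (fun p => A.slotScore u b β p.1 (p.2 u)) lam =
      if b ≤ β ∧ β < b + A.level u.succ then
        negMoment (A.letterOutputLaw W) (fun p => A.chanScore u (β - b) p.1 (p.2 u)) lam
      else 1 := by
  unfold slotScore
  split_ifs
  · rfl
  · simp only [negMoment, Real.one_rpow, mul_one, (hA.letterOutputLaw_mem_stdSimplex hW).2]

theorem sum_letters_wrong_le (hA : A.Valid pS W r) (hW : ∀ x, W x ∈ stdSimplex ℝ (∀ v, Y v))
    {u : Fin (K + 1)} (hu : A.Active u) {M : Type*} [Fintype M] [DecidableEq M]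
    (f : Fin (N + 1) → M) {k : Fin (N + 1)} (hk : k < A.level u.succ) {c₀ : M} (hc : c₀ ≠ f k) :
    ∑ c : Fin (N + 1) × M → V, (∏ i, A.letterLaw i.1 (c i)) *
      ∑ z, W (A.inputMap fun l => c (l, f l)) z *
        A.chanScore u k (fun l => c (l, Function.update f k c₀ l)) (z u) ≤ 1 := by
  have hfresh (c : Fin (N + 1) × M → V) (a : V) (l : Fin (N + 1)) :
      Function.update c (k, c₀) a (l, f l) = c (l, f l) :=
    Function.update_of_ne (fun h => hc <| by
      obtain rfl : l = k := congrArg Prod.fst h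
      exact (congrArg Prod.snd h).symm) _ _
  have hcand (c : Fin (N + 1) × M → V) (a : V) :
      (fun l => Function.update c (k, c₀) a (l, Function.update f k c₀ l)) =
        Function.update (fun l => c (l, f l)) k a := by
    funext l
    rcases eq_or_ne l k with rfl | hne
    · simp only [Function.update_self]
    · simp only [Function.update_of_ne hne, hfresh]
  rw [sum_prod_mul_resample (k, c₀) (hA.sum_letterLaw k)]
  simp only [hfresh, hcand]
  have hletters : ∑ c : Fin (N + 1) × M → V, ∏ i, A.letterLaw i.1 (c i) = 1 :=
    sum_prod_eq_one fun i => hA.sum_letterLaw i.1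
  refine (Finset.sum_le_sum fun c _ => mul_le_of_le_one_right
    (Finset.prod_nonneg fun i _ => hA.letterLaw_nonneg _ _) ?_).trans_eq hletters
  calc ∑ a, A.letterLaw k a * ∑ z, W (A.inputMap fun l => c (l, f l)) z *
        A.chanScore u k (Function.update (fun l => c (l, f l)) k a) (z u)
      = ∑ z, W (A.inputMap fun l => c (l, f l)) z * ∑ a, A.letterLaw k a *
          A.chanScore u k (Function.update (fun l => c (l, f l)) k a) (z u) := by
        simp only [Finset.mul_sum, mul_left_comm (A.letterLaw k _)]
        exact Finset.sum_comm
    _ ≤ ∑ z, W (A.inputMap fun l => c (l, f l)) z :=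
        Finset.sum_le_sum fun z _ =>
          mul_le_of_le_one_right ((hW _).1 z) (hA.sum_chanScore_le u hu k hk _ _)
    _ = 1 := (hW _).2

variable [∀ i, Inhabited (S i)] {m n L : ℕ}

theorem sum_ensembleLaw_mul_score_rpow (hA : A.Valid pS W r)
    (hW : ∀ x, W x ∈ stdSimplex ℝ (∀ v, Y v)) {u : Fin (K + 1)} {b : ℕ}
    (hb : b + A.level u.succ ≤ L) (σ : ℕ → Fin m → S u.succ) (w : ℕ → Fin m → S 0) (lam : ℝ) :
    ∑ ω : Codebook (Fin m → S 0) V N (L * n) × (Fin (L * n) → ∀ v, Y v),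
      A.ensembleLaw W n w ω * A.score n ω.1 u σ (fun t => ω.2 t u) b w (w b) ^ (-lam) =
      (∏ j, A.sideScore u (w b j) (σ b j) ^ (-lam)) * A.chanMoment W u lam ^ n := by
  have hscore (ω : Codebook (Fin m → S 0) V N (L * n) × (Fin (L * n) → ∀ v, Y v)) :
      A.score n ω.1 u σ (fun t => ω.2 t u) b w (w b) ^ (-lam) =
        (∏ j, A.sideScore u (w b j) (σ b j) ^ (-lam)) *
          ∏ t : Fin (L * n), A.slotScore u b (t / n) (word n ω.1 w t) (ω.2 t u) ^ (-lam) := by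
    rw [score, Function.update_eq_self,
      Real.mul_rpow (Finset.prod_nonneg fun _ _ => hA.sideScore_nonneg _ _ _)
        (Finset.prod_nonneg fun _ _ => hA.slotScore_nonneg _ _ _ _ _),
      Real.finsetProd_rpow _ _ fun _ _ => hA.sideScore_nonneg _ _ _,
      Real.finsetProd_rpow _ _ fun _ _ => hA.slotScore_nonneg _ _ _ _ _]
  have hslot (t : Fin (L * n)) :
      ∑ c : Fin (N + 1) × (Fin m → S 0) → V, (∏ i, A.letterLaw i.1 (c i)) *
        ∑ z, W (A.inputMap fun l => c (l, levelMsg N w (t / n) l)) z *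
          A.slotScore u b (t / n) (fun l => c (l, levelMsg N w (t / n) l)) (z u) ^ (-lam) =
      negMoment (A.letterOutputLaw W) (fun p => A.slotScore u b (t / n) p.1 (p.2 u)) lam := by
    refine (sum_prod_mul_comp (fun i => hA.sum_letterLaw i.1)
      (e := fun l => (l, levelMsg N w (t / n) l)) (fun _ _ h => congrArg Prod.fst h)
      fun v => ∑ z, W (A.inputMap v) z * A.slotScore u b (t / n) v (z u) ^ (-lam)).trans ?_
    simp only [negMoment, letterOutputLaw, Fintype.sum_prod_type, Finset.mul_sum, mul_assoc]
  simp only [hscore, mul_left_comm (A.ensembleLaw W n w _), ← Finset.mul_sum]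
  refine congrArg _ ((A.sum_ensembleLaw_mul_prod W w fun t c z =>
    A.slotScore u b (t / n) (fun l => c (l, levelMsg N w (t / n) l)) (z u) ^ (-lam)).trans ?_)
  simp only [hslot, hA.negMoment_slotScore hW]
  exact prod_window hb fun k =>
    negMoment (A.letterOutputLaw W) (fun p => A.chanScore u k p.1 (p.2 u)) lam

theorem sum_ensembleLaw_mul_score_le (hA : A.Valid pS W r)
    (hW : ∀ x, W x ∈ stdSimplex ℝ (∀ v, Y v)) {u : Fin (K + 1)} (hu : A.Active u) (T b : ℕ)
    (σ : ℕ → Fin m → S u.succ) (w : ℕ → Fin m → S 0) {c₀ : Fin m → S 0} (hc : c₀ ≠ w b) :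
    ∑ ω : Codebook (Fin m → S 0) V N T × (Fin T → ∀ v, Y v),
      A.ensembleLaw W n w ω * A.score n ω.1 u σ (fun t => ω.2 t u) b w c₀ ≤
      ∏ j, A.sideScore u (c₀ j) (σ b j) := by
  simp only [score, mul_left_comm (A.ensembleLaw W n w _), ← Finset.mul_sum]
  refine mul_le_of_le_one_right (Finset.prod_nonneg fun _ _ => hA.sideScore_nonneg _ _ _) ?_
  refine (A.sum_ensembleLaw_mul_prod W w fun t c z => A.slotScore u b (t / n)
    (fun l => c (l, levelMsg N (Function.update w b c₀) (t / n) l)) (z u)).trans_le ?_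
  refine Finset.prod_le_one (fun t _ => Finset.sum_nonneg fun c _ => mul_nonneg
    (Finset.prod_nonneg fun _ _ => hA.letterLaw_nonneg _ _) (Finset.sum_nonneg fun z _ =>
      mul_nonneg ((hW _).1 z) (hA.slotScore_nonneg _ _ _ _ _))) fun t _ => ?_
  by_cases ht : b ≤ t / n ∧ t / n < b + A.level u.succ
  · have hN := hu.level_le
    let k : Fin (N + 1) := ⟨t / n - b, by omega⟩
    have hk : k < A.level u.succ := by simp only [Fin.lt_def, k]; omega
    have hkN : (k : ℕ) < N := (Fin.lt_def.1 hk).trans_le hN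
    have htime : t / n = b + k := by simp only [k]; omega
    simp only [slotScore, if_pos ht]
    rw [htime, levelMsg_update w b c₀ hkN, Nat.add_sub_cancel_left]
    exact hA.sum_letters_wrong_le hW hu _ hk (by rwa [levelMsg_add w b hkN])
  · have hletters : ∑ c : Fin (N + 1) × (Fin m → S 0) → V, ∏ i, A.letterLaw i.1 (c i) = 1 :=
      sum_prod_eq_one fun i => hA.sum_letterLaw i.1
    simp only [slotScore, if_neg ht, mul_one, (hW _).2, hletters, le_refl]

theorem sum_ensembleLaw_mul_thresholdLoss_le (hA : A.Valid pS W r)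
    (hW : ∀ x, W x ∈ stdSimplex ℝ (∀ v, Y v)) {u : Fin (K + 1)} (hu : A.Active u) {b : ℕ}
    (hb : b + A.level u.succ ≤ L) {σ : ℕ → Fin m → S u.succ} {w : ℕ → Fin m → S 0}
    (hside : ∑ c ∈ Finset.univ.erase (w b), ∏ j, A.sideScore u (c j) (σ b j) ≤ 1)
    {θ : ℝ} (hθ : 0 < θ) (lam : ℝ) :
    ∑ ω : Codebook (Fin m → S 0) V N (L * n) × (Fin (L * n) → ∀ v, Y v),
      A.ensembleLaw W n w ω *
        thresholdLoss θ lam (A.score n ω.1 u σ (fun t => ω.2 t u) b w) (w b) ≤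
      θ ^ lam * ((∏ j, A.sideScore u (w b j) (σ b j) ^ (-lam)) * A.chanMoment W u lam ^ n) +
        1 / θ := by
  simp only [thresholdLoss, mul_add, Finset.sum_add_distrib]
  refine add_le_add (le_of_eq ?_) ?_
  · simp only [mul_left_comm _ (θ ^ lam), ← Finset.mul_sum]
    rw [hA.sum_ensembleLaw_mul_score_rpow hW hb]
  · simp only [mul_div_assoc', Finset.mul_sum, ← Finset.sum_div]
    refine div_le_div_of_nonneg_right ?_ hθ.le
    rw [Finset.sum_comm]
    exact (Finset.sum_le_sum fun c hc => hA.sum_ensembleLaw_mul_score_le hW hu _ b σ w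
      (Finset.ne_of_mem_erase hc)).trans hside

end Valid

end Ensemble

end Scheme

namespace Scheme

section ExistsCode

variable {K : ℕ} {S : Fin (K + 2) → Type*} {X Y : Fin (K + 1) → Type*} {N : ℕ} {V : Type*}
  {A : Scheme S X Y N V} {B m n : ℕ}

open scoped Classical in
/-- The pairs of a receiver and one of the `B` source blocks, which it has to decode. -/
noncomputable def decodings (A : Scheme S X Y N V) (B : ℕ) : Finset (Fin (K + 1) × ℕ) :=
  Finset.univ.filter A.Active ×ˢ Finset.range B

theorem mem_decodings {q : Fin (K + 1) × ℕ} :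
    q ∈ A.decodings B ↔ A.Active q.1 ∧ q.2 < B := by
  simp [decodings]

variable [∀ i, Fintype (S i)] [∀ i, Inhabited (S i)] {pS : (∀ i, S i) → ℝ}
  {W : (∀ j, X j) → (∀ v, Y v) → ℝ} {r : ℝ}

/-- The negative moment of the score of one symbol of side information. -/
noncomputable def sideMoment (A : Scheme S X Y N V) (pS : (∀ i, S i) → ℝ) (u : Fin (K + 1))
    (lam : ℝ) : ℝ :=
  negMoment pS (fun s => A.sideScore u (s 0) (s u.succ)) lam

theorem sum_prod_mul_sideScore_block (A : Scheme S X Y N V)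
    (hpS : pS ∈ stdSimplex ℝ (∀ i, S i)) (u : Fin (K + 1)) {b : ℕ} (hb : b < B) (lam : ℝ) :
    ∑ s : Fin (B * m) → ∀ i, S i, (∏ l, pS (s l)) * ∏ j : Fin m, A.sideScore u
      (block (fun l => s l 0) b j) (block (fun l => s l u.succ) b j) ^ (-lam) =
      A.sideMoment pS u lam ^ m := by
  have he : Function.Injective fun j : Fin m => finProdFinEquiv ((⟨b, hb⟩ : Fin B), j) :=
    fun j j' h => congrArg Prod.snd (finProdFinEquiv.injective h)
  simp only [block_of_lt _ hb]
  refine (sum_prod_mul_prod_comp (fun _ => hpS.2) he fun _ s =>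
    A.sideScore u (s 0) (s u.succ) ^ (-lam)).trans ?_
  rw [Finset.prod_const, Finset.card_univ, Fintype.card_fin]
  rfl

variable [∀ v, Fintype (Y v)]

open scoped Classical in
theorem errorProb_code_le [∀ v, Inhabited (Y v)] (A : Scheme S X Y N V)
    (hpS : pS ∈ stdSimplex ℝ (∀ i, S i)) (hW : ∀ x, W x ∈ stdSimplex ℝ (∀ v, Y v)) (θ : ℝ)
    (C : Codebook (Fin m → S 0) V N ((B + N) * n)) :
    (A.code θ C).errorProb pS W ≤ ∑ s, (∏ l, pS (s l)) * ∑ y, if ¬ A.Good θ C s y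
      then ∏ t, W (A.inputMap (word n C (block fun l => s l 0) t)) (y t) else 0 := by
  refine Finset.sum_le_sum fun s _ => ?_
  have hideal : ∑ y : Fin ((B + N) * n) → ∀ v, Y v, (∏ l, pS (s l)) *
      ∏ t, W (A.inputMap (word n C (block fun l => s l 0) t)) (y t) = ∏ l, pS (s l) := by
    rw [← Finset.mul_sum, sum_prod_eq_one fun t => (hW _).2, mul_one]
  calc (∑ y, if (A.code θ C).dec (fun t => y t (Fin.last K)) (fun l => s l (Fin.last (K + 1))) ≠
        (fun l => s l 0) then (A.code θ C).prob pS W s y else 0)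
      ≤ ∑ y, if ¬ A.Good θ C s y then (A.code θ C).prob pS W s y else 0 := by
        refine Finset.sum_le_sum fun y _ => ?_
        by_cases h : A.Good θ C s y
        · simp only [h.dec_eq, h, ne_eq, not_true_eq_false, if_false, le_refl]
        · rw [if_pos h]
          split_ifs
          exacts [le_rfl, (A.code θ C).prob_nonneg hpS hW s y]
    _ = ∑ y, if ¬ A.Good θ C s y then (∏ l, pS (s l)) *
          ∏ t, W (A.inputMap (word n C (block fun l => s l 0) t)) (y t) else 0 :=
        sum_not_eq_of_agree (((A.code θ C).sum_prob hW s).trans hideal.symm)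
          fun y h => by simp only [Code.prob, h.input_eq]
    _ = _ := by simp only [Finset.mul_sum, mul_ite, mul_zero]

variable [Fintype V] [DecidableEq (S 0)]

namespace Valid

open scoped Classical in
theorem sum_bookLaw_mul_errorProb_le [∀ v, Inhabited (Y v)] (hA : A.Valid pS W r)
    (hpS : pS ∈ stdSimplex ℝ (∀ i, S i)) (hW : ∀ x, W x ∈ stdSimplex ℝ (∀ v, Y v)) (θ : ℝ) :
    ∑ C : Codebook (Fin m → S 0) V N ((B + N) * n), A.bookLaw C * (A.code θ C).errorProb pS W ≤
      ∑ s : Fin (B * m) → ∀ i, S i, (∏ l, pS (s l)) *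
        ∑ ω : Codebook (Fin m → S 0) V N ((B + N) * n) × (Fin ((B + N) * n) → ∀ v, Y v),
          if ¬ A.Good θ ω.1 s ω.2 then A.ensembleLaw W n (block fun l => s l 0) ω else 0 := by
  refine (Finset.sum_le_sum fun C _ => mul_le_mul_of_nonneg_left (A.errorProb_code_le hpS hW θ C)
    ((hA.bookLaw_mem_stdSimplex _ _).1 C)).trans_eq ?_
  simp only [Finset.mul_sum, Fintype.sum_prod_type, ensembleLaw, mul_ite, mul_zero]
  rw [Finset.sum_comm]
  simp only [mul_left_comm (A.bookLaw _)]

open scoped Classical in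
theorem ite_not_good_le (hA : A.Valid pS W r) (hW : ∀ x, W x ∈ stdSimplex ℝ (∀ v, Y v))
    {θ lam : ℝ} (hθ : 0 < θ) (hlam : 0 ≤ lam) {s : Fin (B * m) → ∀ i, S i}
    (hs : ∀ l, 0 < pS (s l))
    (ω : Codebook (Fin m → S 0) V N ((B + N) * n) × (Fin ((B + N) * n) → ∀ v, Y v)) :
    (if ¬ A.Good θ ω.1 s ω.2 then A.ensembleLaw W n (block fun l => s l 0) ω else 0) ≤
      ∑ q ∈ A.decodings B, A.ensembleLaw W n (block fun l => s l 0) ω *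
        thresholdLoss θ lam (A.genieScore ω.1 q.1 q.2 s ω.2) (block (fun l => s l 0) q.2) := by
  have hscore (q : Fin (K + 1) × ℕ) (c : Fin m → S 0) : 0 ≤ A.genieScore ω.1 q.1 q.2 s ω.2 c :=
    hA.score_nonneg _ _ _ _ _ _ _
  have hω := hA.ensembleLaw_nonneg hW (n := n) (block fun l => s l 0) ω
  have hloss (q : Fin (K + 1) × ℕ) : 0 ≤ A.ensembleLaw W n (block fun l => s l 0) ω *
      thresholdLoss θ lam (A.genieScore ω.1 q.1 q.2 s ω.2) (block (fun l => s l 0) q.2) :=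
    mul_nonneg hω (thresholdLoss_nonneg hθ.le (hscore q))
  split_ifs with h
  · exact Finset.sum_nonneg fun q _ => hloss q
  · rcases hω.eq_or_lt with hzero | hpos
    · rw [← hzero]
      exact Finset.sum_nonneg fun q _ => by simp
    obtain ⟨u, hu, b, hb, hbad⟩ : ∃ u, A.Active u ∧ ∃ b < B, ¬ ∀ c,
        θ ≤ A.genieScore ω.1 u b s ω.2 c ↔ c = block (fun l => s l 0) b := by
      by_contra! hall
      exact h fun u hu b hb => hall u hu b hb
    have htrue : 0 < A.genieScore ω.1 u b s ω.2 (block (fun l => s l 0) b) := by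
      refine hA.score_pos hW hu (fun j => ?_) hpos.ne'
      simp only [block_of_lt _ hb]
      exact hA.sideScore_pos u hu _ (hs _)
    have hone := one_le_thresholdLoss hθ hlam (hscore (u, b)) htrue hbad
    exact (le_mul_of_one_le_right hω hone).trans
      (Finset.single_le_sum (fun q _ => hloss q)
        (mem_decodings.2 ⟨hu, hb⟩ : (u, b) ∈ A.decodings B))

open scoped Classical in
theorem sum_not_good_le (hA : A.Valid pS W r) (hW : ∀ x, W x ∈ stdSimplex ℝ (∀ v, Y v))
    {θ lam : ℝ} (hθ : 0 < θ) (hlam : 0 ≤ lam) {s : Fin (B * m) → ∀ i, S i}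
    (hs : ∀ l, 0 < pS (s l)) (n : ℕ) :
    (∑ ω : Codebook (Fin m → S 0) V N ((B + N) * n) × (Fin ((B + N) * n) → ∀ v, Y v),
      if ¬ A.Good θ ω.1 s ω.2 then A.ensembleLaw W n (block fun l => s l 0) ω else 0) ≤
      ∑ q ∈ A.decodings B, (θ ^ lam * ((∏ j : Fin m, A.sideScore q.1
        (block (fun l => s l 0) q.2 j) (block (fun l => s l q.1.succ) q.2 j) ^ (-lam)) *
          A.chanMoment W q.1 lam ^ n) + 1 / θ) := by
  refine (Finset.sum_le_sum fun ω _ => hA.ite_not_good_le hW hθ hlam hs ω).trans ?_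
  rw [Finset.sum_comm]
  refine Finset.sum_le_sum fun q hq => ?_
  obtain ⟨hu, hb⟩ := mem_decodings.1 hq
  refine hA.sum_ensembleLaw_mul_thresholdLoss_le hW hu (add_le_add hb.le hu.level_le) ?_ hθ lam
  simp only [block_of_lt _ hb]
  exact hA.sum_sideScore_le q.1 hu m _ fun j => hs _

theorem exists_errorProb_le [∀ v, Inhabited (Y v)] (hA : A.Valid pS W r)
    (hpS : pS ∈ stdSimplex ℝ (∀ i, S i)) (hW : ∀ x, W x ∈ stdSimplex ℝ (∀ v, Y v))
    {θ lam : ℝ} (hθ : 0 < θ) (hlam : 0 ≤ lam) (B m n : ℕ) :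
    ∃ c : Code S X Y (B * m) ((B + N) * n), c.errorProb pS W ≤ ∑ q ∈ A.decodings B,
      (θ ^ lam * (A.sideMoment pS q.1 lam ^ m * A.chanMoment W q.1 lam ^ n) + 1 / θ) := by
  classical
  have hmean : ∑ C : Codebook (Fin m → S 0) V N ((B + N) * n),
      A.bookLaw C * (A.code θ C).errorProb pS W ≤ ∑ q ∈ A.decodings B,
        (θ ^ lam * (A.sideMoment pS q.1 lam ^ m * A.chanMoment W q.1 lam ^ n) + 1 / θ) := by
    refine (hA.sum_bookLaw_mul_errorProb_le hpS hW θ).trans ?_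
    calc _ ≤ ∑ s : Fin (B * m) → ∀ i, S i, (∏ l, pS (s l)) * ∑ q ∈ A.decodings B,
          (θ ^ lam * ((∏ j : Fin m, A.sideScore q.1 (block (fun l => s l 0) q.2 j)
            (block (fun l => s l q.1.succ) q.2 j) ^ (-lam)) *
              A.chanMoment W q.1 lam ^ n) + 1 / θ) := by
          refine Finset.sum_le_sum fun s _ => ?_
          by_cases hs : ∀ l, 0 < pS (s l)
          · exact mul_le_mul_of_nonneg_left (hA.sum_not_good_le hW hθ hlam hs n)
              (Finset.prod_nonneg fun _ _ => hpS.1 _)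
          · obtain ⟨l, hl⟩ := not_forall.1 hs
            rw [Finset.prod_eq_zero (Finset.mem_univ l) (le_antisymm (not_lt.1 hl) (hpS.1 _)),
              zero_mul, zero_mul]
      _ = _ := by
          simp only [Finset.mul_sum]
          rw [Finset.sum_comm]
          refine Finset.sum_congr rfl fun q hq => ?_
          have hone : ∑ s : Fin (B * m) → ∀ i, S i, ∏ l, pS (s l) = 1 :=
            sum_prod_eq_one fun _ => hpS.2
          rw [← A.sum_prod_mul_sideScore_block hpS q.1 (mem_decodings.1 hq).2 lam]
          simp only [mul_add, Finset.sum_add_distrib, ← Finset.sum_mul, hone, one_mul,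
            mul_left_comm _ (θ ^ lam), ← mul_assoc _ _ (A.chanMoment W q.1 lam ^ n),
            ← Finset.mul_sum]
  obtain ⟨C, hC⟩ := exists_le_of_sum_mul_le (hA.bookLaw_mem_stdSimplex _ _) hmean
  exact ⟨_, hC⟩

end Valid

end ExistsCode

end Scheme

section Achievability

open Filter Topology

variable {K : ℕ} {S : Fin (K + 2) → Type*} {X Y : Fin (K + 1) → Type*} {N : ℕ}
  [∀ i, Fintype (S i)] [∀ v, Fintype (Y v)] {pS : (∀ i, S i) → ℝ}
  {W : (∀ j, X j) → (∀ v, Y v) → ℝ} {r : ℝ}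

/-- Sending `B` source blocks in `B + N` channel blocks costs an arbitrarily small fraction of the
rate when `B` is large. -/
theorem achievable_of_blocks (hr : 0 < r) {r' : ℝ} (hr' : r' < r)
    (h : ∀ B : ℕ, ∃ c : ∀ n : ℕ, Code S X Y (B * ⌈r * n⌉₊) ((B + N) * n),
      Tendsto (fun n => (c n).errorProb pS W) atTop (𝓝 0)) : Achievable pS W r' := by
  obtain ⟨B₀, hB₀⟩ := exists_nat_ge (r' * N / (r - r'))
  obtain ⟨c, hc⟩ := h (B₀ + 1)
  have hB : r' * N ≤ (B₀ + 1 : ℕ) * (r - r') := by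
    rw [← div_le_iff₀ (sub_pos.2 hr')]
    exact hB₀.trans (Nat.cast_le.2 B₀.le_succ)
  refine ⟨fun q => (B₀ + 1) * ⌈r * (q + 1 : ℕ)⌉₊, fun q => (B₀ + 1 + N) * (q + 1),
    fun q => c (q + 1), fun q => ?_, ?_, ?_, hc.comp (tendsto_add_atTop_nat 1)⟩
  · have hn : 0 < (B₀ + 1 + N) * (q + 1) := by positivity
    refine ⟨hn, (le_div_iff₀ (Nat.cast_pos.2 hn)).2 ?_⟩
    calc r' * ((B₀ + 1 + N) * (q + 1) : ℕ)
        = (r' * (B₀ + 1 : ℕ) + r' * N) * (q + 1 : ℕ) := by push_cast; ring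
      _ ≤ (r' * (B₀ + 1 : ℕ) + (B₀ + 1 : ℕ) * (r - r')) * (q + 1 : ℕ) := by gcongr
      _ = (B₀ + 1 : ℕ) * (r * (q + 1 : ℕ)) := by ring
      _ ≤ (B₀ + 1 : ℕ) * ⌈r * (q + 1 : ℕ)⌉₊ := by gcongr; exact Nat.le_ceil _
      _ = _ := by push_cast; rfl
  · exact tendsto_atTop_mono (fun q => Nat.le_mul_of_pos_left _ B₀.succ_pos)
      (tendsto_nat_ceil_atTop.comp ((tendsto_natCast_atTop_atTop.const_mul_atTop hr).comp
        (tendsto_add_atTop_nat 1)))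
  · exact tendsto_atTop_mono (fun q => Nat.le_mul_of_pos_left _ (by omega))
      (tendsto_add_atTop_nat 1)

namespace Scheme

theorem exp_rpow_mul_pow_mul_pow_le {a R : ℝ} (ha : 0 < a) (hR : 0 < R) (δ lam : ℝ) {m n : ℕ}
    (hm : r * n ≤ m) (hm' : m ≤ r * n + 1) :
    Real.exp (δ * n) ^ lam * (a ^ m * R ^ n) ≤
      Real.exp |Real.log a| * Real.exp (lam * δ + (r * Real.log a + Real.log R)) ^ n := by
  have hround : (m - r * n) * Real.log a ≤ |Real.log a| :=
    calc (m - r * n) * Real.log a ≤ (m - r * n) * |Real.log a| :=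
          mul_le_mul_of_nonneg_left (le_abs_self _) (sub_nonneg.2 hm)
      _ ≤ |Real.log a| := mul_le_of_le_one_left (abs_nonneg _) (by linarith)
  calc Real.exp (δ * n) ^ lam * (a ^ m * R ^ n)
      = Real.exp (δ * n * lam + (m * Real.log a + n * Real.log R)) := by
        rw [Real.exp_add, Real.exp_add, Real.exp_mul (δ * n), Real.exp_nat_mul, Real.exp_nat_mul,
          Real.exp_log ha, Real.exp_log hR]
    _ ≤ Real.exp (|Real.log a| + n * (lam * δ + (r * Real.log a + Real.log R))) :=
        Real.exp_le_exp.2 (by linarith)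
    _ = _ := by rw [Real.exp_add, Real.exp_nat_mul]

variable {V : Type*} [Fintype V] {A : Scheme S X Y N V} {u : Fin (K + 1)}

/-- The exponential rate, per use of the channel in a block, of the negative moment of the score of
a true source block, when there are `r` source symbols per use. -/
noncomputable def exponent (A : Scheme S X Y N V) (pS : (∀ i, S i) → ℝ)
    (W : (∀ j, X j) → (∀ v, Y v) → ℝ) (r : ℝ) (u : Fin (K + 1)) (lam : ℝ) : ℝ :=
  r * Real.log (A.sideMoment pS u lam) + Real.log (A.chanMoment W u lam)

namespace Valid

variable [DecidableEq (S 0)]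

theorem sideMoment_pos (hA : A.Valid pS W r) (hpS : pS ∈ stdSimplex ℝ (∀ i, S i))
    (hu : A.Active u) (lam : ℝ) : 0 < A.sideMoment pS u lam :=
  negMoment_pos hpS (hA.sideScore_pos u hu) lam

theorem negMoment_chanScore_pos (hA : A.Valid pS W r)
    (hW : ∀ x, W x ∈ stdSimplex ℝ (∀ v, Y v)) (hu : A.Active u) {k : ℕ}
    (hk : k ∈ Finset.range (A.level u.succ)) (lam : ℝ) :
    0 < negMoment (A.letterOutputLaw W) (fun p => A.chanScore u k p.1 (p.2 u)) lam :=
  negMoment_pos (hA.letterOutputLaw_mem_stdSimplex hW)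
    (hA.chanScore_pos u hu k (Finset.mem_range.1 hk)) lam

theorem chanMoment_pos (hA : A.Valid pS W r) (hW : ∀ x, W x ∈ stdSimplex ℝ (∀ v, Y v))
    (hu : A.Active u) (lam : ℝ) : 0 < A.chanMoment W u lam :=
  Finset.prod_pos fun _ hk => hA.negMoment_chanScore_pos hW hu hk lam

theorem exponent_zero (hA : A.Valid pS W r) (hpS : pS ∈ stdSimplex ℝ (∀ i, S i))
    (hW : ∀ x, W x ∈ stdSimplex ℝ (∀ v, Y v)) (u : Fin (K + 1)) : A.exponent pS W r u 0 = 0 := by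
  simp [exponent, sideMoment, chanMoment, negMoment_zero, hpS.2,
    (hA.letterOutputLaw_mem_stdSimplex hW).2]

theorem hasDerivAt_exponent_zero (hA : A.Valid pS W r) (hpS : pS ∈ stdSimplex ℝ (∀ i, S i))
    (hW : ∀ x, W x ∈ stdSimplex ℝ (∀ v, Y v)) (hu : A.Active u) :
    HasDerivAt (A.exponent pS W r u)
      (r * -∑ s, pS s * Real.log (A.sideScore u (s 0) (s u.succ)) +
        ∑ k ∈ Finset.range (A.level u.succ),
          -∑ p, A.letterOutputLaw W p * Real.log (A.chanScore u k p.1 (p.2 u))) 0 := by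
  have hlog (lam : ℝ) : Real.log (A.chanMoment W u lam) = ∑ k ∈ Finset.range (A.level u.succ),
      Real.log (negMoment (A.letterOutputLaw W) (fun p => A.chanScore u k p.1 (p.2 u)) lam) :=
    Real.log_prod fun k hk => (hA.negMoment_chanScore_pos hW hu hk lam).ne'
  unfold exponent
  simp only [hlog]
  exact ((hasDerivAt_log_negMoment_zero hpS (hA.sideScore_pos u hu)).const_mul r).add
    (HasDerivAt.fun_sum fun k hk => hasDerivAt_log_negMoment_zero
      (hA.letterOutputLaw_mem_stdSimplex hW) (hA.chanScore_pos u hu k (Finset.mem_range.1 hk)))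

theorem eventually_exponent_neg (hA : A.Valid pS W r) (hpS : pS ∈ stdSimplex ℝ (∀ i, S i))
    (hW : ∀ x, W x ∈ stdSimplex ℝ (∀ v, Y v)) (hu : A.Active u) :
    ∀ᶠ lam in 𝓝[>] 0, A.exponent pS W r u lam < 0 := by
  have hdrift := hA.drift_pos u hu
  have hderiv := hA.hasDerivAt_exponent_zero hpS hW hu
  rw [mul_neg, Finset.sum_neg_distrib, ← neg_add] at hderiv
  simpa only [hA.exponent_zero hpS hW] using
    eventually_lt_of_hasDerivAt_neg hderiv (neg_lt_zero.2 hdrift)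

theorem exists_exponent_neg (hA : A.Valid pS W r) (hpS : pS ∈ stdSimplex ℝ (∀ i, S i))
    (hW : ∀ x, W x ∈ stdSimplex ℝ (∀ v, Y v)) :
    ∃ lam > 0, ∃ δ > 0, ∀ u, A.Active u → lam * δ + A.exponent pS W r u lam < 0 := by
  have hlam : ∀ᶠ lam in 𝓝[>] (0 : ℝ), ∀ u, A.Active u → A.exponent pS W r u lam < 0 :=
    eventually_all.2 fun u => eventually_imp_distrib_left.2 fun hu =>
      hA.eventually_exponent_neg hpS hW hu
  obtain ⟨lam, hneg, hpos⟩ := (hlam.and self_mem_nhdsWithin).exists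
  have hδ : ∀ᶠ δ in 𝓝[>] (0 : ℝ), ∀ u, A.Active u → lam * δ + A.exponent pS W r u lam < 0 := by
    refine eventually_all.2 fun u => eventually_imp_distrib_left.2 fun hu => ?_
    have hcont : Continuous fun δ : ℝ => lam * δ + A.exponent pS W r u lam := by fun_prop
    exact (hcont.tendsto 0).mono_left nhdsWithin_le_nhds |>.eventually
      (gt_mem_nhds (by simpa using hneg u hu))
  obtain ⟨δ, hδneg, hδpos⟩ := (hδ.and self_mem_nhdsWithin).exists
  exact ⟨lam, hpos, δ, hδpos, hδneg⟩

variable [∀ i, Inhabited (S i)] [∀ v, Inhabited (Y v)]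

theorem exists_tendsto_errorProb (hA : A.Valid pS W r) (hr : 0 ≤ r)
    (hpS : pS ∈ stdSimplex ℝ (∀ i, S i)) (hW : ∀ x, W x ∈ stdSimplex ℝ (∀ v, Y v)) (B : ℕ) :
    ∃ c : ∀ n : ℕ, Code S X Y (B * ⌈r * n⌉₊) ((B + N) * n),
      Tendsto (fun n => (c n).errorProb pS W) atTop (𝓝 0) := by
  obtain ⟨lam, hlam, δ, hδ, hneg⟩ := hA.exists_exponent_neg hpS hW
  choose c hc using fun n : ℕ =>
    hA.exists_errorProb_le hpS hW (Real.exp_pos (δ * n)) hlam.le B ⌈r * n⌉₊ n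
  refine ⟨c, squeeze_zero (fun n => (c n).errorProb_nonneg hpS hW)
    (g := fun n => ∑ q ∈ A.decodings B, (Real.exp |Real.log (A.sideMoment pS q.1 lam)| *
      Real.exp (lam * δ + A.exponent pS W r q.1 lam) ^ n + Real.exp (-δ) ^ n))
    (fun n => (hc n).trans (Finset.sum_le_sum fun q hq => add_le_add ?_ (le_of_eq ?_))) ?_⟩
  · have hu := (mem_decodings.1 hq).1
    exact exp_rpow_mul_pow_mul_pow_le (hA.sideMoment_pos hpS hu lam) (hA.chanMoment_pos hW hu lam)
      δ lam (Nat.le_ceil _) (Nat.ceil_lt_add_one (by positivity)).le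
  · rw [one_div, ← Real.exp_neg, ← Real.exp_nat_mul, mul_neg, mul_comm δ]
  · have hdecay {a : ℝ} (ha : a < 0) : Tendsto (fun n : ℕ => Real.exp a ^ n) atTop (𝓝 0) :=
      tendsto_pow_atTop_nhds_zero_of_lt_one (Real.exp_pos a).le (Real.exp_lt_one_iff.2 ha)
    refine (tendsto_finsetSum _ fun q hq => ((hdecay (hneg q.1 (mem_decodings.1 hq).1)).const_mul
      (Real.exp |Real.log (A.sideMoment pS q.1 lam)|)).add
        (hdecay (neg_lt_zero.2 hδ))).trans_eq ?_
    simp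

theorem achievable (hA : A.Valid pS W r) (hr : 0 < r) {r' : ℝ} (hr' : r' < r)
    (hpS : pS ∈ stdSimplex ℝ (∀ i, S i)) (hW : ∀ x, W x ∈ stdSimplex ℝ (∀ v, Y v)) :
    Achievable pS W r' :=
  achievable_of_blocks hr hr' fun B => hA.exists_tendsto_errorProb hr.le hpS hW B

end Valid

end Scheme

end Achievability

section Cooperation

variable {K N : ℕ} {π : Fin (N + 1) → Fin (K + 2)}

/-- The transmitters of level at least `k`, that is, `π(k), …, π(N - 1)`; see `after`. -/
def tail (π : Fin (N + 1) → Fin (K + 2)) (k : ℕ) : Finset (Fin (K + 1)) :=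
  {j | ∃ l : Fin (N + 1), k ≤ l ∧ π l = j.castSucc}

theorem mem_tail {k : ℕ} {j : Fin (K + 1)} :
    j ∈ tail π k ↔ ∃ l : Fin (N + 1), k ≤ l ∧ π l = j.castSucc := by
  simp only [tail, Finset.mem_filter_univ]

theorem tail_antitone (π : Fin (N + 1) → Fin (K + 2)) : Antitone (tail π) := by
  intro k k' hk j hj
  obtain ⟨l, hl, hπl⟩ := mem_tail.1 hj
  exact mem_tail.2 ⟨l, hk.trans hl, hπl⟩

theorem tail_eq_empty (hπN : π (Fin.last N) = Fin.last (K + 1)) : tail π N = ∅ := by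
  refine Finset.eq_empty_of_forall_notMem fun j hj => ?_
  obtain ⟨l, hl, hπl⟩ := mem_tail.1 hj
  rw [Fin.last_le_iff.1 hl, hπN] at hπl
  exact (Fin.castSucc_lt_last j).ne' hπl

theorem cooperating_eq_tail (π : Fin (N + 1) → Fin (K + 2)) : cooperating π = tail π 0 := by
  ext j
  simp [cooperating, mem_tail]

theorem after_eq_tail (π : Fin (N + 1) → Fin (K + 2)) (i : Fin (N + 1)) :
    after π i = tail π i := by
  ext j
  simp [after, mem_tail]

theorem before_union_after (π : Fin (N + 1) → Fin (K + 2)) (i : Fin (N + 1)) :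
    before π i ∪ after π i = cooperating π := by
  ext j
  simp only [before, after, cooperating, Finset.mem_union, Finset.mem_filter_univ, ← exists_or,
    ← or_and_right, lt_or_ge, true_and]

theorem sub_union_eq_iff {X : Fin (K + 1) → Type*} {A B : Finset (Fin (K + 1))}
    {x x' : ∀ j, X j} :
    sub (A ∪ B) x = sub (A ∪ B) x' ↔ sub A x = sub A x' ∧ sub B x = sub B x' := by
  simp only [sub, funext_iff, Subtype.forall, Finset.mem_union, or_imp, forall_and]

/-- The position of a terminal in the order `π`; the terminals outside the image of `π`, which need
not decode anything, are placed at the level of the destination. -/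
noncomputable def levelOf (π : Fin (N + 1) → Fin (K + 2)) : Fin (K + 2) → Fin (N + 1) :=
  Function.extend π id fun _ => Fin.last N

theorem levelOf_apply (hπ : Function.Injective π) (i : Fin (N + 1)) : levelOf π (π i) = i :=
  hπ.extend_apply _ _ i

theorem exists_eq_of_levelOf_lt {t : Fin (K + 2)} (ht : levelOf π t < Fin.last N) :
    ∃ i, π i = t := by
  by_contra h
  exact ht.ne (Function.extend_apply' _ _ t h)

theorem inputOf_tail_congr {X : Fin (K + 1) → Type*} (hπ : Function.Injective π) {x₀ : ∀ j, X j}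
    {v v' : Fin (N + 1) → Strategy X} {j : Fin (K + 1)}
    (h : ∀ l, levelOf π j.castSucc ≤ l → v l = v' l) :
    inputOf (tail π) x₀ v j = inputOf (tail π) x₀ v' j := by
  unfold inputOf
  by_cases hj : j ∈ tail π 0
  · obtain ⟨l, -, hl⟩ := mem_tail.1 hj
    rw [← hl, levelOf_apply hπ] at h
    have hjl : j ∈ tail π l := mem_tail.2 ⟨l, le_rfl, hl⟩
    rw [Finset.piecewise_eq_of_mem _ _ _ hj, Finset.piecewise_eq_of_mem _ _ _ hj,
      stage_apply_of_mem (tail_antitone π) v (Nat.zero_le l) hjl,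
      stage_apply_of_mem (tail_antitone π) v' (Nat.zero_le l) hjl, stage_congr l h]
  · rw [Finset.piecewise_eq_of_notMem _ _ _ hj, Finset.piecewise_eq_of_notMem _ _ _ hj,
      stage_congr N fun i hi => h i ((Fin.le_last _).trans hi)]

end Cooperation

section PosteriorScore

variable {K : ℕ} {S : Fin (K + 2) → Type*} [∀ i, Fintype (S i)] {pS : (∀ i, S i) → ℝ}

/-- The score of a source symbol given the side information of the terminal `i`: its posterior
probability, doubled if `H(S_0 | S_i) = 0`.  In that case only the true symbol has positive
posterior probability, and the factor makes the expected logarithm of its score positive. -/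
noncomputable def posteriorScore (pS : (∀ i, S i) → ℝ) (i : Fin (K + 2)) (a : S 0) (b : S i) : ℝ :=
  (if sourceEntropy pS i = 0 then 2 else 1) * condProb pS (fun s => s 0) (fun s => s i) a b

theorem posteriorScore_nonneg (hpS : ∀ s, 0 ≤ pS s) (i : Fin (K + 2)) (a : S 0) (b : S i) :
    0 ≤ posteriorScore pS i a b :=
  mul_nonneg (by split_ifs <;> norm_num) (condProb_nonneg hpS _ _ _ _)

theorem posteriorScore_pos (hpS : ∀ s, 0 ≤ pS s) (i : Fin (K + 2)) {s : ∀ i, S i}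
    (hs : 0 < pS s) : 0 < posteriorScore pS i (s 0) (s i) :=
  mul_pos (by split_ifs <;> norm_num) (condProb_pos hpS (fun s => s 0) (fun s => s i) hs)

theorem sum_prod_posteriorScore_le_one [DecidableEq (S 0)] (hpS : ∀ s, 0 ≤ pS s)
    (i : Fin (K + 2)) {m : ℕ} {s : Fin m → ∀ i, S i} (hs : ∀ l, 0 < pS (s l)) :
    ∑ c ∈ Finset.univ.erase (fun l => s l 0), ∏ l, posteriorScore pS i (c l) (s l i) ≤ 1 := by
  by_cases h : sourceEntropy pS i = 0
  · refine (Finset.sum_eq_zero fun c hc => ?_).trans_le zero_le_one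
    obtain ⟨l, hl⟩ := Function.ne_iff.1 (Finset.ne_of_mem_erase hc)
    refine Finset.prod_eq_zero (Finset.mem_univ l) ?_
    rw [posteriorScore, condProb_eq_zero_of_condEntropy_eq_zero hpS h (hs l) hl, mul_zero]
  · simp only [posteriorScore, if_neg h, one_mul]
    calc ∑ c ∈ Finset.univ.erase (fun l => s l 0),
          ∏ l, condProb pS (fun s => s 0) (fun s => s i) (c l) (s l i)
        ≤ ∑ c : Fin m → S 0, ∏ l, condProb pS (fun s => s 0) (fun s => s i) (c l) (s l i) :=
          Finset.sum_le_sum_of_subset_of_nonneg (Finset.erase_subset _ _) fun c _ _ =>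
            Finset.prod_nonneg fun l _ => condProb_nonneg hpS _ _ _ _
      _ = ∏ l, ∑ a, condProb pS (fun s => s 0) (fun s => s i) a (s l i) :=
          (Fintype.prod_sum fun l a => condProb pS (fun s => s 0) (fun s => s i) a (s l i)).symm
      _ ≤ 1 := Finset.prod_le_one
          (fun l _ => Finset.sum_nonneg fun a _ => condProb_nonneg hpS _ _ _ _)
          fun l _ => sum_condProb_le_one pS _ _ _

theorem sum_mul_log_posteriorScore (hpS : pS ∈ stdSimplex ℝ (∀ i, S i)) (i : Fin (K + 2)) :
    ∑ s, pS s * Real.log (posteriorScore pS i (s 0) (s i)) =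
      if sourceEntropy pS i = 0 then Real.log 2 else -sourceEntropy pS i := by
  split_ifs with h
  · rw [← one_mul (Real.log 2), ← hpS.2, Finset.sum_mul]
    refine Finset.sum_congr rfl fun s _ => ?_
    rcases (hpS.1 s).eq_or_lt with hs | hs
    · rw [← hs, zero_mul, zero_mul]
    · rw [posteriorScore, if_pos h, condProb_eq_one_of_condEntropy_eq_zero hpS.1 h hs, mul_one]
  · simp only [posteriorScore, if_neg h, one_mul]
    rw [sourceEntropy, condEntropy_eq_neg_sum, neg_neg]

end PosteriorScore

section OutputProb

variable {K N : ℕ} {X Y : Fin (K + 1) → Type*} [∀ j, Fintype (X j)] [∀ v, Fintype (Y v)]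
  {pX : (∀ j, X j) → ℝ} {W : (∀ j, X j) → (∀ v, Y v) → ℝ}

/-- The probability `P(Y_u = b | X_A = x_A)`, equal to `0` if `P(X_A = x_A) = 0`. -/
noncomputable def outputProb (pX : (∀ j, X j) → ℝ) (W : (∀ j, X j) → (∀ v, Y v) → ℝ)
    (A : Finset (Fin (K + 1))) (u : Fin (K + 1)) (x : ∀ j, X j) (b : Y u) : ℝ :=
  condMean pX (fun x' => law (W x') (fun y => y u) b) A.restrict x

theorem outputProb_nonneg (hpX : ∀ x, 0 ≤ pX x) (hW : ∀ x y, 0 ≤ W x y)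
    (A : Finset (Fin (K + 1))) (u : Fin (K + 1)) (x : ∀ j, X j) (b : Y u) :
    0 ≤ outputProb pX W A u x b :=
  condMean_nonneg hpX (fun x' => law_nonneg (hW x') _ b) _ x

theorem outputProb_pos (hpX : ∀ x, 0 ≤ pX x) (hW : ∀ x y, 0 ≤ W x y)
    (A : Finset (Fin (K + 1))) (u : Fin (K + 1)) {x : ∀ j, X j} {y : ∀ v, Y v}
    (hx : 0 < pX x) (hy : 0 < W x y) : 0 < outputProb pX W A u x (y u) :=
  condMean_pos hpX (fun x' => law_nonneg (hW x') _ (y u)) _ hx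
    (law_pos (hW x) (fun y => y u) hy)

theorem law_jointLaw_fst {α : Type*} (hW : ∀ x, ∑ y, W x y = 1) (f : (∀ j, X j) → α) (a : α) :
    law (jointLaw pX W) (fun xy => f xy.1) a = law pX f a := by
  simp only [law, jointLaw, Fintype.sum_prod_type]
  refine Finset.sum_congr rfl fun x _ => ?_
  split_ifs
  · rw [← Finset.mul_sum, hW, mul_one]
  · exact Finset.sum_const_zero

theorem law_jointLaw_pair {α : Type*} (u : Fin (K + 1)) (f : (∀ j, X j) → α) (b : Y u) (a : α) :
    law (jointLaw pX W) (fun xy => (xy.2 u, f xy.1)) (b, a) =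
      law (fun x => pX x * law (W x) (fun y => y u) b) f a := by
  classical
  simp only [law, jointLaw, Fintype.sum_prod_type, Finset.mul_sum, Prod.mk.injEq]
  refine Finset.sum_congr rfl fun x _ => ?_
  by_cases h : f x = a <;> simp [h]

theorem outputProb_eq_div (hW : ∀ x, ∑ y, W x y = 1) (A : Finset (Fin (K + 1))) (u : Fin (K + 1))
    (x : ∀ j, X j) (b : Y u) :
    outputProb pX W A u x b =
      law (jointLaw pX W) (fun xy => (xy.2 u, sub A xy.1)) (b, sub A x) /
        law (jointLaw pX W) (fun xy => sub A xy.1) (sub A x) := by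
  rw [law_jointLaw_pair, law_jointLaw_fst hW]
  rfl

variable {π : Fin (N + 1) → Fin (K + 2)}

theorem rateInfo_eq_sum (hW : ∀ x, ∑ y, W x y = 1) (i : Fin (N + 1)) (u : Fin (K + 1)) :
    rateInfo pX W π i u = ∑ xy, jointLaw pX W xy * Real.log
      (outputProb pX W (tail π 0) u xy.1 (xy.2 u) /
        outputProb pX W (tail π i) u xy.1 (xy.2 u)) := by
  rw [rateInfo, condMutualInfo_eq_sum]
  refine Finset.sum_congr rfl fun xy _ => ?_
  rw [← cooperating_eq_tail, ← after_eq_tail, ← before_union_after π i, outputProb_eq_div hW,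
    outputProb_eq_div hW, div_div_div_eq]
  congr 4
  · exact law_congr _ fun _ => by simp only [Prod.mk.injEq, sub_union_eq_iff, and_left_comm]
  · exact law_congr _ fun _ => by simp only [Prod.mk.injEq, sub_union_eq_iff]

theorem sum_range_sum_log_outputProb (hpX : ∀ x, 0 ≤ pX x)
    (hW : ∀ x, W x ∈ stdSimplex ℝ (∀ v, Y v)) (i : Fin (N + 1)) (u : Fin (K + 1)) :
    ∑ k ∈ Finset.range i, ∑ xy, jointLaw pX W xy * Real.log
      (outputProb pX W (tail π k) u xy.1 (xy.2 u) /
        outputProb pX W (tail π (k + 1)) u xy.1 (xy.2 u)) = rateInfo pX W π i u := by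
  rw [rateInfo_eq_sum fun x => (hW x).2, Finset.sum_comm]
  refine Finset.sum_congr rfl fun xy _ => ?_
  rw [← Finset.mul_sum]
  rcases (mul_nonneg (hpX xy.1) ((hW xy.1).1 xy.2)).eq_or_lt with h | h
  · rw [jointLaw, ← h, zero_mul, zero_mul]
  · have hx : 0 < pX xy.1 := pos_of_mul_pos_left h ((hW xy.1).1 xy.2)
    have hlog (k l : ℕ) : Real.log (outputProb pX W (tail π k) u xy.1 (xy.2 u) /
        outputProb pX W (tail π l) u xy.1 (xy.2 u)) =
        Real.log (outputProb pX W (tail π k) u xy.1 (xy.2 u)) -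
          Real.log (outputProb pX W (tail π l) u xy.1 (xy.2 u)) := by
      have hpos (k : ℕ) := outputProb_pos hpX (fun x => (hW x).1) (tail π k) u hx
        (pos_of_mul_pos_right h hx.le)
      exact Real.log_div (hpos k).ne' (hpos l).ne'
    simp only [hlog]
    rw [Finset.sum_range_sub']

end OutputProb

section DecodeForward

variable {K N : ℕ} {S : Fin (K + 2) → Type*} {X Y : Fin (K + 1) → Type*}
  [∀ i, Fintype (S i)] [∀ j, Fintype (X j)] [∀ v, Fintype (Y v)]
  {pS : (∀ i, S i) → ℝ} {pX : (∀ j, X j) → ℝ} {W : (∀ j, X j) → (∀ v, Y v) → ℝ}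
  {π : Fin (N + 1) → Fin (K + 2)} {x₀ : ∀ j, X j}

/-- The factor that the letter of level `k` contributes to the score of a candidate: the density of
the output given the inputs of level at least `k`, relative to its density given the inputs of
higher level.  Where the side information determines the source, the channel is ignored. -/
noncomputable def densityScore (pS : (∀ i, S i) → ℝ) (pX : (∀ j, X j) → ℝ)
    (W : (∀ j, X j) → (∀ v, Y v) → ℝ) (π : Fin (N + 1) → Fin (K + 2)) (x₀ : ∀ j, X j)
    (u : Fin (K + 1)) (k : ℕ) (v : Fin (N + 1) → Strategy X) (b : Y u) : ℝ :=
  if sourceEntropy pS u.succ = 0 then 1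
  else outputProb pX W (tail π k) u (stage (tail π) x₀ v k) b /
    outputProb pX W (tail π (k + 1)) u (stage (tail π) x₀ v (k + 1)) b

theorem densityScore_congr {u : Fin (K + 1)} {k : ℕ} {v v' : Fin (N + 1) → Strategy X} (b : Y u)
    (h : ∀ l : Fin (N + 1), k ≤ l → v l = v' l) :
    densityScore pS pX W π x₀ u k v b = densityScore pS pX W π x₀ u k v' b := by
  rw [densityScore, densityScore, stage_congr k h,
    stage_congr (k + 1) fun l hl => h l (k.le_succ.trans hl)]

theorem densityScore_eq (u : Fin (K + 1)) (k : ℕ) (v : Fin (N + 1) → Strategy X) (b : Y u) :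
    densityScore pS pX W π x₀ u k v b = if sourceEntropy pS u.succ = 0 then 1 else
      outputProb pX W (tail π k) u (inputOf (tail π) x₀ v) b /
        outputProb pX W (tail π (k + 1)) u (inputOf (tail π) x₀ v) b := by
  have hinput {l : ℕ} : outputProb pX W (tail π l) u (stage (tail π) x₀ v l) b =
      outputProb pX W (tail π l) u (inputOf (tail π) x₀ v) b :=
    condMean_congr _ _ (restrict_stage (tail_antitone π) v le_rfl)
  rw [densityScore, hinput, hinput]

theorem densityScore_nonneg (hpX : ∀ x, 0 ≤ pX x) (hW : ∀ x y, 0 ≤ W x y) (u : Fin (K + 1))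
    (k : ℕ) (v : Fin (N + 1) → Strategy X) (b : Y u) :
    0 ≤ densityScore pS pX W π x₀ u k v b := by
  rw [densityScore]
  split_ifs
  · exact zero_le_one
  · exact div_nonneg (outputProb_nonneg hpX hW _ _ _ _) (outputProb_nonneg hpX hW _ _ _ _)

theorem densityScore_pos (hpX : ∀ x, 0 ≤ pX x) (hW : ∀ x y, 0 ≤ W x y) (u : Fin (K + 1))
    (k : ℕ) {v : Fin (N + 1) → Strategy X} {y : ∀ v, Y v}
    (hv : 0 < pX (inputOf (tail π) x₀ v)) (hy : 0 < W (inputOf (tail π) x₀ v) y) :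
    0 < densityScore pS pX W π x₀ u k v (y u) := by
  rw [densityScore_eq]
  split_ifs
  · exact zero_lt_one
  · exact div_pos (outputProb_pos hpX hW _ u hv hy) (outputProb_pos hpX hW _ u hv hy)

variable [∀ j, DecidableEq (X j)]

theorem sum_strategyLaw_mul_densityScore_le_one (hpX : ∀ x, 0 ≤ pX x) (u : Fin (K + 1))
    (k : Fin (N + 1)) (v : Fin (N + 1) → Strategy X) (b : Y u) :
    ∑ a, strategyLaw pX (tail π) k a *
      densityScore pS pX W π x₀ u k (Function.update v k a) b ≤ 1 := by
  simp only [densityScore]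
  split_ifs
  · simp only [mul_one, sum_strategyLaw, le_refl]
  · have hsub : tail π (k + 1) ⊆ tail π k := tail_antitone π (Nat.le_succ k)
    have hcoarse (a : Strategy X) :
        outputProb pX W (tail π (k + 1)) u
          (stage (tail π) x₀ (Function.update v k a) (k + 1)) b =
        outputProb pX W (tail π (k + 1)) u
          (stage (tail π) x₀ (Function.update v k a) k) b := by
      refine condMean_congr _ _ ?_
      rw [restrict_stage (tail_antitone π) _ le_rfl,
        restrict_stage (tail_antitone π) _ (Nat.le_succ k)]
    simp only [hcoarse]
    exact (sum_strategyLaw_mul_stage_update k.2 v fun x =>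
      outputProb pX W (tail π k) u x b / outputProb pX W (tail π (k + 1)) u x b).trans_le
        (sum_condLaw_mul_condMean_div_le_one hpX _ (tail π k).restrict
          (Finset.restrict₂ hsub) _)

end DecodeForward

section DecodeForward

variable {K N : ℕ} {S : Fin (K + 2) → Type*} {X Y : Fin (K + 1) → Type*}
  [∀ i, Fintype (S i)] [∀ j, Fintype (X j)] [∀ v, Fintype (Y v)]
  {pS : (∀ i, S i) → ℝ} {pX : (∀ j, X j) → ℝ} {W : (∀ j, X j) → (∀ v, Y v) → ℝ}
  {π : Fin (N + 1) → Fin (K + 2)} {x₀ : ∀ j, X j}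

/-- The decode-and-forward scheme in which the terminals `π(0), …, π(N)` decode in this order. -/
noncomputable def decodeForward (pS : (∀ i, S i) → ℝ) (pX : (∀ j, X j) → ℝ)
    (W : (∀ j, X j) → (∀ v, Y v) → ℝ) (x₀ : ∀ j, X j) (hπ : Function.Injective π)
    (hπN : π (Fin.last N) = Fin.last (K + 1)) : Scheme S X Y N (Strategy X) where
  letterLaw k := strategyLaw pX (tail π) k
  inputMap := inputOf (tail π) x₀
  level := levelOf π
  level_last := hπN ▸ levelOf_apply hπ (Fin.last N)
  inputMap_congr _ _ _ := inputOf_tail_congr hπ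
  sideScore u := posteriorScore pS u.succ
  chanScore := densityScore pS pX W π x₀
  chanScore_congr _ _ _ _ := densityScore_congr

variable {hπ : Function.Injective π} {hπN : π (Fin.last N) = Fin.last (K + 1)}

theorem exists_eq_succ_of_active {u : Fin (K + 1)}
    (hu : (decodeForward pS pX W x₀ hπ hπN).Active u) : ∃ i, π i = u.succ := by
  rcases hu with rfl | hu
  · exact ⟨Fin.last N, hπN⟩
  · exact exists_eq_of_levelOf_lt hu

theorem sum_letterOutputLaw_mul [∀ j, DecidableEq (X j)] (hpX : pX ∈ stdSimplex ℝ (∀ j, X j))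
    (hN : 0 < N) (hind : IndepOfRest pX (cooperating π)) (F : (∀ j, X j) × (∀ v, Y v) → ℝ) :
    ∑ p, (decodeForward pS pX W x₀ hπ hπN).letterOutputLaw W p *
        F (inputOf (tail π) x₀ p.1, p.2) =
      ∑ xy, jointLaw pX W xy * F xy := by
  rw [cooperating_eq_tail] at hind
  simp only [Scheme.letterOutputLaw, jointLaw, Fintype.sum_prod_type, mul_assoc, ← Finset.mul_sum]
  exact sum_prod_strategyLaw_mul_inputOf hpX (tail_antitone π) (tail_eq_empty hπN) hN hind
    fun x => ∑ y, W x y * F (x, y)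

theorem jointLaw_pos_of_letterOutputLaw_pos (hpX : pX ∈ stdSimplex ℝ (∀ j, X j))
    (hW : ∀ x y, 0 ≤ W x y) (hN : 0 < N) (hind : IndepOfRest pX (cooperating π))
    {p : (Fin (N + 1) → Strategy X) × (∀ v, Y v)}
    (hp : 0 < (decodeForward pS pX W x₀ hπ hπN).letterOutputLaw W p) :
    0 < jointLaw pX W (inputOf (tail π) x₀ p.1, p.2) := by
  classical
  by_contra! hle
  have hzero : jointLaw pX W (inputOf (tail π) x₀ p.1, p.2) = 0 :=
    hle.antisymm (mul_nonneg (hpX.1 _) (hW _ _))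
  have hnull := sum_letterOutputLaw_mul (pS := pS) (x₀ := x₀) (hπ := hπ) (hπN := hπN) (W := W)
    hpX hN hind fun xy => if jointLaw pX W xy = 0 then 1 else 0
  have hzero_sum : ∑ xy, jointLaw pX W xy * (if jointLaw pX W xy = 0 then 1 else 0) = 0 :=
    Finset.sum_eq_zero fun xy _ => by split_ifs with h <;> simp [h]
  rw [hzero_sum] at hnull
  refine hp.not_ge (le_of_eq_of_le ?_
    (hnull ▸ Finset.single_le_sum (fun p _ => ?_) (Finset.mem_univ p)))
  · rw [if_pos hzero, mul_one]
  · exact mul_nonneg (mul_nonneg (Finset.prod_nonneg fun l _ => strategyLaw_nonneg hpX.1 l _)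
      (hW _ _)) (by split_ifs <;> norm_num)

variable [∀ j, DecidableEq (X j)]

theorem sum_letterOutputLaw_mul_log_densityScore (hpX : pX ∈ stdSimplex ℝ (∀ j, X j))
    (hW : ∀ x, W x ∈ stdSimplex ℝ (∀ v, Y v)) (hN : 0 < N)
    (hind : IndepOfRest pX (cooperating π)) (i : Fin (N + 1)) (u : Fin (K + 1)) :
    ∑ k ∈ Finset.range i, ∑ p, (decodeForward pS pX W x₀ hπ hπN).letterOutputLaw W p *
        Real.log (densityScore pS pX W π x₀ u k p.1 (p.2 u)) =
      if sourceEntropy pS u.succ = 0 then 0 else rateInfo pX W π i u := by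
  simp only [densityScore_eq]
  split_ifs
  · simp only [Real.log_one, mul_zero, Finset.sum_const_zero]
  · rw [← sum_range_sum_log_outputProb hpX.1 hW]
    exact Finset.sum_congr rfl fun k _ => sum_letterOutputLaw_mul hpX hN hind fun xy => Real.log
      (outputProb pX W (tail π k) u xy.1 (xy.2 u) /
        outputProb pX W (tail π (k + 1)) u xy.1 (xy.2 u))

theorem decodeForward_drift_pos (hpS : pS ∈ stdSimplex ℝ (∀ i, S i))
    (hpX : pX ∈ stdSimplex ℝ (∀ j, X j)) (hW : ∀ x, W x ∈ stdSimplex ℝ (∀ v, Y v))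
    (hN : 0 < N) (hind : IndepOfRest pX (cooperating π)) {r : ℝ} (hr0 : 0 < r)
    (hr : ∀ i v, π i = v.succ → sourceEntropy pS (π i) ≠ 0 →
      r < rateInfo pX W π i v / sourceEntropy pS (π i))
    {u : Fin (K + 1)} (hu : (decodeForward pS pX W x₀ hπ hπN).Active u) :
    0 < r * ∑ s, pS s * Real.log (posteriorScore pS u.succ (s 0) (s u.succ)) +
      ∑ k ∈ Finset.range (levelOf π u.succ),
        ∑ p, (decodeForward pS pX W x₀ hπ hπN).letterOutputLaw W p *
          Real.log (densityScore pS pX W π x₀ u k p.1 (p.2 u)) := by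
  obtain ⟨i, hi⟩ := exists_eq_succ_of_active hu
  rw [← hi, levelOf_apply hπ, hi, sum_mul_log_posteriorScore hpS,
    sum_letterOutputLaw_mul_log_densityScore hpX hW hN hind]
  split_ifs with h
  · have := Real.log_pos one_lt_two
    positivity
  · have hpos : 0 < sourceEntropy pS u.succ := (condEntropy_nonneg hpS.1 _ _).lt_of_ne' h
    have hrate := hr i u hi (hi ▸ h)
    rw [hi, lt_div_iff₀ hpos] at hrate
    linarith

theorem decodeForward_valid [DecidableEq (S 0)] (hpS : pS ∈ stdSimplex ℝ (∀ i, S i))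
    (hpX : pX ∈ stdSimplex ℝ (∀ j, X j)) (hW : ∀ x, W x ∈ stdSimplex ℝ (∀ v, Y v))
    (hN : 0 < N) (hind : IndepOfRest pX (cooperating π)) {r : ℝ} (hr0 : 0 < r)
    (hr : ∀ i v, π i = v.succ → sourceEntropy pS (π i) ≠ 0 →
      r < rateInfo pX W π i v / sourceEntropy pS (π i)) :
    (decodeForward pS pX W x₀ hπ hπN).Valid pS W r where
  letterLaw_nonneg k := strategyLaw_nonneg hpX.1 k
  sum_letterLaw k := sum_strategyLaw pX (tail π) k
  sideScore_nonneg u := posteriorScore_nonneg hpS.1 u.succ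
  sideScore_pos u _ _ := posteriorScore_pos hpS.1 u.succ
  sum_sideScore_le u _ _ _ := sum_prod_posteriorScore_le_one hpS.1 u.succ
  chanScore_nonneg := densityScore_nonneg hpX.1 fun x => (hW x).1
  chanScore_pos u _ k _ p hp := by
    have hjoint := jointLaw_pos_of_letterOutputLaw_pos hpX (fun x => (hW x).1) hN hind hp
    have hx := pos_of_mul_pos_left hjoint ((hW _).1 _)
    exact densityScore_pos hpX.1 (fun x => (hW x).1) u k hx (pos_of_mul_pos_right hjoint hx.le)
  sum_chanScore_le u _ k _ := sum_strategyLaw_mul_densityScore_le_one hpX.1 u k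
  drift_pos _ := decodeForward_drift_pos hpS hpX hW hN hind hr0 hr

end DecodeForward

theorem exists_rate_gt {K N : ℕ} {π : Fin (N + 1) → Fin (K + 2)} {r : ℝ}
    {I : Fin (N + 1) → Fin (K + 1) → ℝ} {H : Fin (N + 1) → ℝ}
    (hr : ∀ i v, π i = v.succ → H i ≠ 0 → r < I i v / H i) :
    ∃ r' > r, ∀ i v, π i = v.succ → H i ≠ 0 → r' < I i v / H i := by
  have hev : ∀ᶠ r' in nhds r, ∀ i v, π i = v.succ → H i ≠ 0 → r' < I i v / H i := by
    simp only [Filter.eventually_all]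
    exact fun i v hi hH => gt_mem_nhds (hr i v hi hH)
  obtain ⟨r', hr', hgt⟩ :=
    ((hev.filter_mono nhdsWithin_le_nhds).and (self_mem_nhdsWithin (s := Set.Ioi r))).exists
  exact ⟨r', hgt, hr'⟩

end RelayNetwork

/-- If `π 0` is not the source, then `hr` at `i = 0`, where the rate information is `0`, says that
`H(S_0 | S_{π 0}) = 0`. -/
theorem theorem1_general {K : ℕ} {S : Fin (K + 2) → Type*} {X Y : Fin (K + 1) → Type*}
    [∀ i, Fintype (S i)] [∀ j, Fintype (X j)] [∀ v, Fintype (Y v)]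
    (pS : (∀ i, S i) → ℝ) (hpS : pS ∈ stdSimplex ℝ (∀ i, S i))
    (W : (∀ j, X j) → (∀ v, Y v) → ℝ) (hW : ∀ x, W x ∈ stdSimplex ℝ (∀ v, Y v))
    (r : ℝ) (hr0 : 0 ≤ r) (N : ℕ) (hN1 : 1 ≤ N)
    (π : Fin (N + 1) → Fin (K + 2)) (hπ : Function.Injective π)
    (hπN : π (Fin.last N) = Fin.last (K + 1))
    (pX : (∀ j, X j) → ℝ) (hpX : pX ∈ stdSimplex ℝ (∀ j, X j))
    (hind : RelayNetwork.IndepOfRest pX (RelayNetwork.cooperating π))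
    (hr : ∀ (i : Fin (N + 1)) (v : Fin (K + 1)), π i = v.succ →
      RelayNetwork.sourceEntropy pS (π i) ≠ 0 →
      r < RelayNetwork.rateInfo pX W π i v / RelayNetwork.sourceEntropy pS (π i)) :
    RelayNetwork.Achievable pS W r := by
  classical
  obtain ⟨s₀, -⟩ := RelayNetwork.exists_pos_of_mem_stdSimplex hpS
  obtain ⟨x₀, -⟩ := RelayNetwork.exists_pos_of_mem_stdSimplex hpX
  obtain ⟨y₀, -⟩ := RelayNetwork.exists_pos_of_mem_stdSimplex (hW x₀)
  let _ (i : Fin (K + 2)) : Inhabited (S i) := ⟨s₀ i⟩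
  let _ (v : Fin (K + 1)) : Inhabited (Y v) := ⟨y₀ v⟩
  obtain ⟨r', hrr', hr'⟩ := RelayNetwork.exists_rate_gt hr
  have hvalid := RelayNetwork.decodeForward_valid (x₀ := x₀) (hπ := hπ) (hπN := hπN)
    hpS hpX hW hN1 hind (hr0.trans_lt hrr') hr'
  exact hvalid.achievable (hr0.trans_lt hrr') hrr' hpS hW

/-- In `hr`, the index `v` with `π i = v.succ` is the channel output of terminal `π i`; it exists
exactly for `i = 1, …, N`.  A quotient with denominator `H(S_0 | S_{π i}) = 0` counts as `+∞`. -/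
theorem theorem1 {K : ℕ} {S : Fin (K + 2) → Type*} {X Y : Fin (K + 1) → Type*}
    [∀ i, Fintype (S i)] [∀ j, Fintype (X j)] [∀ v, Fintype (Y v)]
    (pS : (∀ i, S i) → ℝ) (hpS : pS ∈ stdSimplex ℝ (∀ i, S i))
    (W : (∀ j, X j) → (∀ v, Y v) → ℝ) (hW : ∀ x, W x ∈ stdSimplex ℝ (∀ v, Y v))
    (r : ℝ) (hr0 : 0 ≤ r)
    (N : ℕ) (hN1 : 1 ≤ N) (hNK : N ≤ K + 1)
    (π : Fin (N + 1) → Fin (K + 2)) (hπ : Function.Injective π)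
    (hπ0 : π 0 = 0) (hπN : π (Fin.last N) = Fin.last (K + 1))
    (pX : (∀ j, X j) → ℝ) (hpX : pX ∈ stdSimplex ℝ (∀ j, X j))
    (hind : RelayNetwork.IndepOfRest pX (RelayNetwork.cooperating π))
    (hr : ∀ (i : Fin (N + 1)) (v : Fin (K + 1)), π i = v.succ →
      RelayNetwork.sourceEntropy pS (π i) ≠ 0 →
      r < RelayNetwork.rateInfo pX W π i v / RelayNetwork.sourceEntropy pS (π i)) :
    RelayNetwork.Achievable pS W r :=
  theorem1_general pS hpS W hW r hr0 N hN1 π hπ hπN pX hpX hind hr
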